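/- Let $\Omega\subset\mathbb R^2$ be a bounded domain with Lipschitz boundary and let $k\ge 0$. For $j=1,2$ let $D_j$ be an open polygon (the bounded region enclosed by a simple closed polygonal line) with $\overline{D_j}\subset\Omega$, and let $\rho_j\in L^2(D_j)$. Assume that for each vertex $p$ of $D_j$ there exist an open disk $B(p,\eta)$ with $\eta>0$, an exponent $0<\alpha\le 1$ and a function $\tilde\rho\in C^{0,\alpha}(\overline{B(p,\eta)})$ such that $\rho_j=\tilde\rho$ almost everywhere on $B(p,\eta)\cap D_j$ and $\tilde\rho(p)\neq 0$. Put $F_j=\rho_j\chi_{D_j}$, that is, $F_j(w)=\int_{D_j}\rho_j w\,dx$, and let $u_j\in H^1(\Omega)$ be a weak solution of $$\Delta u_j+k^2u_j=F_j\quad\text{in }\Omega .$$ Let $u_j|_{\partial\Omega}\in H^{1/2}(\partial\Omega)$ be the trace of $u_j$, and let the Neumann derivative $\partial u_j/\partial\nu|_{\partial\Omega}$ be the functional on $H^{1/2}(\partial\Omega)$ given by $$\Big\langle\frac{\partial u_j}{\partial\nu}\Big|_{\partial\Omega},g\Big\rangle=\int_\Omega\nabla u_j\cdot\nabla w\,dx-k^2\int_\Omega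 u_jw\,dx+\int_{D_j}\rho_jw\,dx,$$ where $w\in H^1(\Omega)$ is any lifting of $g$. If $$\Big(u_1|_{\partial\Omega},\frac{\partial u_1}{\partial\nu}\Big|_{\partial\Omega}\Big)=\Big(u_2|_{\partial\Omega},\frac{\partial u_2}{\partial\nu}\Big|_{\partial\Omega}\Big),$$ then the convex hulls of $D_1$ and $D_2$ coincide: $[D_1]=[D_2]$. -/

import Mathlib

open MeasureTheory Filter Topology
open scoped ContDiff NNReal

/-- The Euclidean plane. -/
abbrev Plane : Type := EuclideanSpace ℝ (Fin 2)

/-- A two-dimensional bounded domain with Lipschitz boundary: near each boundary point, in suitable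
Cartesian coordinates, the set is the part of the plane strictly above the graph of a Lipschitz
function. -/
structure IsBoundedLipschitzDomain (Ω : Set Plane) : Prop where
  isOpen : IsOpen Ω
  isConnected : IsConnected Ω
  isBounded : Bornology.IsBounded Ω
  lipschitz_boundary : ∀ p ∈ frontier Ω,
    ∃ (e : Plane ≃ᵃⁱ[ℝ] Plane) (K : ℝ≥0) (γ : ℝ → ℝ) (U : Set Plane),
      LipschitzWith K γ ∧ U ∈ 𝓝 p ∧ ∀ x ∈ U, x ∈ Ω ↔ γ (e x 0) < e x 1

/-- The partial derivative `∂ᵢ φ`. -/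
noncomputable def partialDeriv (i : Fin 2) (φ : Plane → ℂ) (x : Plane) : ℂ :=
  fderiv ℝ φ x (EuclideanSpace.single i (1 : ℝ))

/-- The elements of `C₀^∞(Ω)`. -/
structure IsTestFunction (Ω : Set Plane) (φ : Plane → ℂ) : Prop where
  contDiff : ContDiff ℝ ∞ φ
  hasCompactSupport : HasCompactSupport φ
  tsupport_subset : tsupport φ ⊆ Ω

/-- An element of the Sobolev space `H¹(Ω)`, given by a representative of the function and
representatives of its weak partial derivatives, all in `L²(Ω)`. (Values outside `Ω` and on null
sets play no role in anything below.) -/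
structure H1 (Ω : Set Plane) where
  /-- the function -/
  toFun : Plane → ℂ
  /-- the weak partial derivatives -/
  grad : Fin 2 → Plane → ℂ
  memLp : MemLp toFun 2 (volume.restrict Ω)
  grad_memLp : ∀ i, MemLp (grad i) 2 (volume.restrict Ω)
  weak_deriv : ∀ i φ, IsTestFunction Ω φ →
    ∫ x in Ω, toFun x * partialDeriv i φ x = - ∫ x in Ω, grad i x * φ x

/-- The smooth functions `φ n` converge to `u` in the norm of `H¹(Ω)`. -/
def TendstoH1 {Ω : Set Plane} (φ : ℕ → Plane → ℂ) (u : H1 Ω) : Prop :=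
  Tendsto (fun n => eLpNorm (fun x => φ n x - u.toFun x) 2 (volume.restrict Ω)) atTop (𝓝 0) ∧
  ∀ i, Tendsto (fun n => eLpNorm (fun x => partialDeriv i (φ n) x - u.grad i x) 2
    (volume.restrict Ω)) atTop (𝓝 0)

/-- `u ∈ H¹₀(Ω)`, the closure of `C₀^∞(Ω)` in `H¹(Ω)`. -/
def IsH10 {Ω : Set Plane} (u : H1 Ω) : Prop :=
  ∃ φ : ℕ → Plane → ℂ, (∀ n, IsTestFunction Ω (φ n)) ∧ TendstoH1 φ u

/-- Arc length on `∂Ω`. -/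
noncomputable abbrev boundaryMeasure (Ω : Set Plane) : Measure Plane :=
  (Measure.hausdorffMeasure 1).restrict (frontier Ω)

/-- `g ∈ L²(∂Ω)` is the trace `u|_{∂Ω}` of `u ∈ H¹(Ω)`: the trace operator is the continuous
extension to `H¹(Ω)` of the restriction to `∂Ω` of functions that are smooth on the plane. -/
def IsTrace {Ω : Set Plane} (u : H1 Ω) (g : Lp ℂ 2 (boundaryMeasure Ω)) : Prop :=
  ∃ φ : ℕ → Plane → ℂ, (∀ n, ContDiff ℝ ∞ (φ n)) ∧ TendstoH1 φ u ∧
    Tendsto (fun n => eLpNorm (fun x => φ n x - g x) 2 (boundaryMeasure Ω)) atTop (𝓝 0)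

section TraceSpace

theorem continuous_partialDeriv {φ : Plane → ℂ} (h : ContDiff ℝ ∞ φ)
    (i : Fin 2) : Continuous (partialDeriv i φ) :=
  (h.continuous_fderiv (by simp)).clm_apply continuous_const

theorem IsTestFunction.memLp {Ω : Set Plane} {φ : Plane → ℂ} (h : IsTestFunction Ω φ) :
    MemLp φ 2 (volume.restrict Ω) :=
  h.contDiff.continuous.memLp_of_hasCompactSupport h.hasCompactSupport

theorem IsTestFunction.memLp_partialDeriv {Ω : Set Plane} {φ : Plane → ℂ}
    (h : IsTestFunction Ω φ) (i : Fin 2) : MemLp (partialDeriv i φ) 2 (volume.restrict Ω) :=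
  (continuous_partialDeriv h.contDiff i).memLp_of_hasCompactSupport
    (h.hasCompactSupport.fderiv_apply ℝ _)

/-- The zero element of `H¹(Ω)`. -/
def H1.zero (Ω : Set Plane) : H1 Ω where
  toFun := fun _ => 0
  grad := fun _ _ => 0
  memLp := MemLp.zero'
  grad_memLp := fun _ => MemLp.zero'
  weak_deriv := by simp

/-- The sum of two elements of `H¹(Ω)`. -/
def H1.add {Ω : Set Plane} (u w : H1 Ω) : H1 Ω where
  toFun := fun x => u.toFun x + w.toFun x
  grad := fun i x => u.grad i x + w.grad i x
  memLp := u.memLp.add w.memLp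
  grad_memLp := fun i => (u.grad_memLp i).add (w.grad_memLp i)
  weak_deriv := by
    intro i φ h
    simp only [add_mul]
    have e1 := integral_add (u.memLp.integrable_mul (h.memLp_partialDeriv i))
      (w.memLp.integrable_mul (h.memLp_partialDeriv i))
    have e2 := integral_add ((u.grad_memLp i).integrable_mul h.memLp)
      ((w.grad_memLp i).integrable_mul h.memLp)
    simp only [Pi.mul_apply] at e1 e2
    rw [e1, e2, u.weak_deriv i φ h, w.weak_deriv i φ h]
    ring

/-- A scalar multiple of an element of `H¹(Ω)`. -/
def H1.smul {Ω : Set Plane} (c : ℂ) (u : H1 Ω) : H1 Ω where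
  toFun := fun x => c * u.toFun x
  grad := fun i x => c * u.grad i x
  memLp := u.memLp.const_mul c
  grad_memLp := fun i => (u.grad_memLp i).const_mul c
  weak_deriv := by
    intro i φ h
    simp only [mul_assoc]
    rw [integral_const_mul, integral_const_mul, u.weak_deriv i φ h]
    ring

theorem tendsto_eLpNorm_add {μ : Measure Plane} {a b : ℕ → Plane → ℂ}
    (ha : ∀ n, AEStronglyMeasurable (a n) μ) (hb : ∀ n, AEStronglyMeasurable (b n) μ)
    (hta : Tendsto (fun n => eLpNorm (a n) 2 μ) atTop (𝓝 0))
    (htb : Tendsto (fun n => eLpNorm (b n) 2 μ) atTop (𝓝 0)) :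
    Tendsto (fun n => eLpNorm (a n + b n) 2 μ) atTop (𝓝 0) := by
  have h := hta.add htb
  rw [add_zero] at h
  exact tendsto_of_tendsto_of_tendsto_of_le_of_le tendsto_const_nhds h (fun _ => zero_le)
    (fun n => eLpNorm_add_le (ha n) (hb n) (by norm_num))

theorem tendsto_eLpNorm_const_mul {μ : Measure Plane} {a : ℕ → Plane → ℂ} (c : ℂ)
    (hta : Tendsto (fun n => eLpNorm (a n) 2 μ) atTop (𝓝 0)) :
    Tendsto (fun n => eLpNorm (c • a n) 2 μ) atTop (𝓝 0) := by
  simp only [eLpNorm_const_smul]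
  simpa using ENNReal.Tendsto.const_mul hta (Or.inr (by simp : ‖c‖ₑ ≠ ⊤))

theorem partialDeriv_add {φ ψ : Plane → ℂ} (hφ : ContDiff ℝ ∞ φ) (hψ : ContDiff ℝ ∞ ψ)
    (i : Fin 2) (x : Plane) :
    partialDeriv i (fun y => φ y + ψ y) x = partialDeriv i φ x + partialDeriv i ψ x := by
  have h1 := (hφ.differentiable (by simp)) x
  have h2 := (hψ.differentiable (by simp)) x
  simp only [partialDeriv]
  rw [fderiv_fun_add h1 h2]
  rfl

theorem partialDeriv_const_mul {φ : Plane → ℂ} (hφ : ContDiff ℝ ∞ φ) (c : ℂ)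
    (i : Fin 2) (x : Plane) :
    partialDeriv i (fun y => c * φ y) x = c * partialDeriv i φ x := by
  have h1 := (hφ.differentiable (by simp)) x
  simp only [partialDeriv]
  rw [fderiv_const_mul h1]
  rfl

theorem IsTrace.zero (Ω : Set Plane) : IsTrace (H1.zero Ω) 0 := by
  refine ⟨fun _ _ => 0, fun _ => contDiff_const, ⟨?_, fun i => ?_⟩, ?_⟩
  · simp [H1.zero]
  · simp [H1.zero, partialDeriv]
  · have : ∀ n : ℕ, eLpNorm (fun x => (0 : ℂ) - (0 : Lp ℂ 2 (boundaryMeasure Ω)) x) 2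
        (boundaryMeasure Ω) = 0 := by
      intro _
      rw [← eLpNorm_zero (ε := ℂ) (p := 2) (μ := boundaryMeasure Ω)]
      apply eLpNorm_congr_ae
      filter_upwards [Lp.coeFn_zero ℂ 2 (boundaryMeasure Ω)] with x hx
      rw [hx]
      simp
    exact (tendsto_congr this).2 tendsto_const_nhds

theorem IsTrace.add {Ω : Set Plane} {u w : H1 Ω} {g h : Lp ℂ 2 (boundaryMeasure Ω)}
    (hu : IsTrace u g) (hw : IsTrace w h) : IsTrace (u.add w) (g + h) := by
  obtain ⟨φ, hφ, ⟨hφ0, hφ1⟩, hφb⟩ := hu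
  obtain ⟨ψ, hψ, ⟨hψ0, hψ1⟩, hψb⟩ := hw
  refine ⟨fun n x => φ n x + ψ n x, fun n => (hφ n).add (hψ n), ⟨?_, fun i => ?_⟩, ?_⟩
  · refine (tendsto_eLpNorm_add
      (fun n => (hφ n).continuous.aestronglyMeasurable.sub u.memLp.1)
      (fun n => (hψ n).continuous.aestronglyMeasurable.sub w.memLp.1) hφ0 hψ0).congr ?_
    intro n
    congr 1
    ext x
    simp only [Pi.add_apply, Pi.sub_apply, H1.add]
    ring
  · refine (tendsto_eLpNorm_add
      (fun n => (continuous_partialDeriv (hφ n) i).aestronglyMeasurable.sub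
        (u.grad_memLp i).1)
      (fun n => (continuous_partialDeriv (hψ n) i).aestronglyMeasurable.sub
        (w.grad_memLp i).1) (hφ1 i) (hψ1 i)).congr ?_
    intro n
    congr 1
    ext x
    simp only [Pi.add_apply, Pi.sub_apply, H1.add, partialDeriv_add (hφ n) (hψ n)]
    ring
  · refine (tendsto_eLpNorm_add
      (fun n => (hφ n).continuous.aestronglyMeasurable.sub (Lp.aestronglyMeasurable g))
      (fun n => (hψ n).continuous.aestronglyMeasurable.sub (Lp.aestronglyMeasurable h))
      hφb hψb).congr ?_
    intro n
    apply eLpNorm_congr_ae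
    filter_upwards [Lp.coeFn_add g h] with x hx
    simp only [Pi.add_apply, Pi.sub_apply, hx]
    ring

theorem IsTrace.smul {Ω : Set Plane} {u : H1 Ω} {g : Lp ℂ 2 (boundaryMeasure Ω)} (c : ℂ)
    (hu : IsTrace u g) : IsTrace (u.smul c) (c • g) := by
  obtain ⟨φ, hφ, ⟨hφ0, hφ1⟩, hφb⟩ := hu
  refine ⟨fun n x => c * φ n x, fun n => contDiff_const.mul (hφ n), ⟨?_, fun i => ?_⟩, ?_⟩
  · refine (tendsto_eLpNorm_const_mul c hφ0).congr ?_
    intro n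
    congr 1
    ext x
    simp only [Pi.smul_apply, smul_eq_mul, H1.smul]
    ring
  · refine (tendsto_eLpNorm_const_mul c (hφ1 i)).congr ?_
    intro n
    congr 1
    ext x
    simp only [Pi.smul_apply, smul_eq_mul, H1.smul, partialDeriv_const_mul (hφ n)]
    ring
  · refine (tendsto_eLpNorm_const_mul c hφb).congr ?_
    intro n
    apply eLpNorm_congr_ae
    filter_upwards [Lp.coeFn_smul c g] with x hx
    simp only [Pi.smul_apply, smul_eq_mul, hx]
    ring

end TraceSpace

/-- `H^{1/2}(∂Ω)`, the space of traces of elements of `H¹(Ω)`. -/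
def HHalf (Ω : Set Plane) : Submodule ℂ (Lp ℂ 2 (boundaryMeasure Ω)) where
  carrier := {g | ∃ w : H1 Ω, IsTrace w g}
  zero_mem' := ⟨H1.zero Ω, IsTrace.zero Ω⟩
  add_mem' := fun ⟨u, hu⟩ ⟨w, hw⟩ => ⟨u.add w, hu.add hw⟩
  smul_mem' := fun c _ ⟨u, hu⟩ => ⟨u.smul c, hu.smul c⟩

/-- The bilinear form `∫_Ω ∇u·∇w - k² ∫_Ω u w`. -/
noncomputable def helmholtzForm {Ω : Set Plane} (k : ℝ) (u w : H1 Ω) : ℂ :=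
  (∫ x in Ω, ∑ i, u.grad i x * w.grad i x) - (k : ℂ) ^ 2 * ∫ x in Ω, u.toFun x * w.toFun x

/-- The functional `w ↦ ∫_D ρ w` on `H¹(Ω)`. On `H¹₀(Ω)` it is the source `F = ρ χ_D`; on `H¹(Ω)`
it is the extension `w ↦ F(ψ w)`, where `ψ ∈ C₀^∞(Ω)` is any cut-off function equal to `1` near
`supp F`, because `ψ ρ = ρ` almost everywhere on `D`. -/
noncomputable def sourceFunctional (Ω D : Set Plane) (ρ : Plane → ℂ) (w : H1 Ω) : ℂ :=
  ∫ x in D, ρ x * w.toFun x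

/-- `u ∈ H¹(Ω)` is a weak solution of `Δu + k² u = F` in `Ω`. -/
def IsWeakSolution {Ω : Set Plane} (k : ℝ) (F : H1 Ω → ℂ) (u : H1 Ω) : Prop :=
  ∀ w : H1 Ω, IsH10 w → -helmholtzForm k u w = F w

/-- The functional `N` on `H^{1/2}(∂Ω)` is the Neumann derivative `∂u/∂ν|_{∂Ω}` of a weak solution
`u` of `Δu + k² u = F`: for every `g ∈ H^{1/2}(∂Ω)` and every lifting `w ∈ H¹(Ω)` of `g`,
`⟨N, g⟩ = ∫_Ω ∇u·∇w - k² ∫_Ω u w + F(w)`. (Boundedness of `N` follows from this formula.) -/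
def IsNeumannDerivative {Ω : Set Plane} (k : ℝ) (F : H1 Ω → ℂ) (u : H1 Ω)
    (N : HHalf Ω →ₗ[ℂ] ℂ) : Prop :=
  ∀ (g : HHalf Ω) (w : H1 Ω), IsTrace w (g : Lp ℂ 2 (boundaryMeasure Ω)) →
    N g = helmholtzForm k u w + F w

/-- `(f, N)` is the pair of Cauchy data `(u|_{∂Ω}, ∂u/∂ν|_{∂Ω})` of a weak solution `u` of
`Δu + k² u = F` in `Ω`. -/
def IsCauchyData {Ω : Set Plane} (k : ℝ) (F : H1 Ω → ℂ) (u : H1 Ω)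
    (f : HHalf Ω) (N : HHalf Ω →ₗ[ℂ] ℂ) : Prop :=
  IsTrace u (f : Lp ℂ 2 (boundaryMeasure Ω)) ∧ IsNeumannDerivative k F u N

/-- `D` is the open polygon with the (cyclically ordered) vertices `v 0, …, v (m + 2)`: it is the
bounded open connected set whose boundary is the simple closed polygonal line through these points,
and at each of them the boundary has a genuine corner. Indices are cyclic. -/
structure IsPolygonWithVertices (D : Set Plane) {m : ℕ} (v : Fin (m + 3) → Plane) : Prop where
  isOpen : IsOpen D
  isConnected : IsConnected D
  isBounded : Bornology.IsBounded D
  injective : Function.Injective v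
  corner : ∀ i, ¬ Collinear ℝ {v (i - 1), v i, v (i + 1)}
  adjacent_edges : ∀ i, segment ℝ (v (i - 1)) (v i) ∩ segment ℝ (v i) (v (i + 1)) = {v i}
  other_edges : ∀ i j, j ≠ i → j ≠ i + 1 → i ≠ j + 1 →
    Disjoint (segment ℝ (v i) (v (i + 1))) (segment ℝ (v j) (v (j + 1)))
  frontier_eq : frontier D = ⋃ i, segment ℝ (v i) (v (i + 1))

/-- `D` is an (open) polygon. -/
def IsPolygon (D : Set Plane) : Prop :=
  ∃ (m : ℕ) (v : Fin (m + 3) → Plane), IsPolygonWithVertices D v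

/-- `p` is a vertex of the polygon `D`. -/
def IsVertex (D : Set Plane) (p : Plane) : Prop :=
  ∃ (m : ℕ) (v : Fin (m + 3) → Plane), IsPolygonWithVertices D v ∧ p ∈ Set.range v

/-- The assumptions on the pair `(D, ρ)`: `D` is a polygon with `closure D ⊆ Ω`, `ρ ∈ L²(D)`, and
near each vertex `p` of `D` the function `ρ` coincides on `D` with a Hölder continuous function on
a closed disk centred at `p` that does not vanish at `p`. -/
structure IsAdmissiblePair (Ω D : Set Plane) (ρ : Plane → ℂ) : Prop where
  closure_subset : closure D ⊆ Ω
  isPolygon : IsPolygon D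
  memLp : MemLp ρ 2 (volume.restrict D)
  vertex : ∀ p, IsVertex D p → ∃ (η : ℝ) (α C : ℝ≥0) (ρ' : Plane → ℂ),
    0 < η ∧ 0 < α ∧ α ≤ 1 ∧ HolderOnWith C α ρ' (Metric.closedBall p η) ∧
    (∀ᵐ x ∂(volume.restrict (Metric.ball p η ∩ D)), ρ x = ρ' x) ∧ ρ' p ≠ 0

/-! Test the Neumann identity with exponentials `w = exp (z·x)`, where `z` is complex and `z·z =
-k²`, so that `w` solves the Helmholtz equation. The difference of the two solutions has zero trace,
so its bilinear form with `w` vanishes by Green's formula. Hence `ρ₁ χ_{D₁}` and `ρ₂ χ_{D₂}` have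
the same moments against all such `w` (`sourceFunctional_expWave_eq`).

Now take `z = τ ξ + i s ξ^⊥` with `s ≈ τ → ∞`. Then `|w| = exp (τ ξ·x)` concentrates on the part of
`D` farthest in the direction `ξ`. For generic `ξ` this is a single vertex `p`, near which `D` is a
convex sector with edge vectors `a`, `b`. Scaling by `τ` gives the moment centred at `p` the leading
term `c ρ(p) / (A B) τ⁻²`, where `A = ξ·a + i ξ^⊥·a`, likewise `B`, and `c` is a Jacobian. It is
nonzero because `ρ(p) ≠ 0` (`IsAdmissiblePair.exists_tendsto_moment`).

If `D₁` were not contained in the hull of `D₂`, some such `ξ` would see `D₁` protrude strictly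
beyond `D₂`. Centred at the extremal vertex of `D₁`, the moment of `D₂` is exponentially small while
that of `D₁` is of order `τ⁻²`, a contradiction. By symmetry the hulls coincide.

The Green's formula needed is modest. The trace is a limit of smooth functions, so the bound `|∫_Ω
∂ᵢf| ≤ C ∫_{∂Ω} |f|` replaces the divergence theorem, and neither a normal nor an exact surface
formula is required. -/

/-! ### Change of variables to linear coordinates -/

/-- Linear coordinates on the plane with respect to a pair of linearly independent vectors. -/
theorem exists_continuousLinearEquiv_of_linearIndependent {a b : Plane}
    (h : LinearIndependent ℝ ![a, b]) :
    ∃ Λ : (ℝ × ℝ) ≃L[ℝ] Plane, ∀ z, Λ z = z.1 • a + z.2 • b := by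
  let f : (ℝ × ℝ) →ₗ[ℝ] Plane :=
    (LinearMap.fst ℝ ℝ ℝ).smulRight a + (LinearMap.snd ℝ ℝ ℝ).smulRight b
  have hf : ∀ z, f z = z.1 • a + z.2 • b := fun z => rfl
  have hinj : Function.Injective f := by
    rw [← LinearMap.ker_eq_bot, LinearMap.ker_eq_bot']
    intro z hz
    rw [hf] at hz
    obtain ⟨h1, h2⟩ := LinearIndependent.pair_iff.1 h _ _ hz
    exact Prod.ext h1 h2
  have hd : Module.finrank ℝ (ℝ × ℝ) = Module.finrank ℝ Plane := by simp
  refine ⟨(f.linearEquivOfInjective hinj hd).toContinuousLinearEquiv, fun z => ?_⟩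
  simp [hf]

/-- Uniqueness of Haar measure. The value of the Jacobian never matters, only that it is nonzero,
since it survives as a factor of the limiting moment. -/
theorem exists_map_continuousLinearEquiv_eq_smul (Λ : (ℝ × ℝ) ≃L[ℝ] Plane) (p : Plane) :
    ∃ c : ℝ≥0, c ≠ 0 ∧
      (volume : Measure Plane) = c • Measure.map (fun z => p + Λ z) (volume : Measure (ℝ × ℝ)) := by
  have := Λ.isAddHaarMeasure_map (volume : Measure (ℝ × ℝ))
  have h1 := Measure.isAddLeftInvariant_eq_smul (volume : Measure Plane)
    (Measure.map Λ (volume : Measure (ℝ × ℝ)))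
  refine ⟨_, (Measure.addHaarScalarFactor_pos_of_isAddHaarMeasure (volume : Measure Plane)
    (Measure.map Λ (volume : Measure (ℝ × ℝ)))).ne', ?_⟩
  conv_lhs => rw [h1]
  congr 1
  rw [show (fun z => p + Λ z) = (fun x => p + x) ∘ Λ from rfl,
    ← Measure.map_map (by fun_prop) (by fun_prop), map_add_left_eq_self]

theorem exists_integral_eq_smul_integral_comp (Λ : (ℝ × ℝ) ≃L[ℝ] Plane) (p : Plane) :
    ∃ c : ℝ≥0, c ≠ 0 ∧ ∀ f : Plane → ℂ, ∫ x, f x = (c : ℝ) • ∫ z : ℝ × ℝ, f (p + Λ z) := by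
  obtain ⟨c, hc, h⟩ := exists_map_continuousLinearEquiv_eq_smul Λ p
  refine ⟨c, hc, fun f => ?_⟩
  have he : MeasurableEmbedding (fun z => p + Λ z) :=
    (Λ.toHomeomorph.trans (Homeomorph.addLeft p)).measurableEmbedding
  rw [h, integral_smul_nnreal_measure, he.integral_map]
  rfl

/-! ### The boundary estimate on Lipschitz domains -/

/-- The part of the boundary on which a set is the strict epigraph of a continuous function
dominates the parameter measure. -/
theorem map_restrict_le_smul_boundaryMeasure {Ω : Set Plane} {c : ℝ → Plane} (hc : Continuous c)
    {π : Plane → ℝ} {K : ℝ≥0} (hπ : LipschitzWith K π) (hl : Function.LeftInverse π c) :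
    Measure.map c (volume.restrict (c ⁻¹' frontier Ω)) ≤ K • boundaryMeasure Ω := by
  refine Measure.le_iff.2 fun A hA => ?_
  rw [Measure.map_apply hc.measurable hA, Measure.restrict_apply (hc.measurable hA),
    Measure.smul_apply, Measure.restrict_apply hA, ← Set.preimage_inter]
  -- The Lipschitz projection `π` recovers the parameter, so parameter length is at most `K` times
  -- arc length; the curve itself need only be continuous.
  calc volume (c ⁻¹' (A ∩ frontier Ω)) ≤ volume (π '' (A ∩ frontier Ω)) := by
        refine measure_mono fun s hs => ⟨c s, hs, hl s⟩
    _ = Measure.hausdorffMeasure 1 (π '' (A ∩ frontier Ω)) := by rw [hausdorffMeasure_real]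
    _ ≤ _ := by
        refine (hπ.hausdorffMeasure_image_le zero_le_one _).trans ?_
        simp [ENNReal.smul_def]

/-- The divergence theorem, as an inequality, in a part of an open set that is an epigraph in the
direction `Λ (0, 1)`. -/
theorem exists_enorm_setIntegral_fderiv_le_of_epigraph {Ω U : Set Plane} (hΩ : IsOpen Ω) (hUo : IsOpen U)
    (Λ : (ℝ × ℝ) ≃L[ℝ] Plane) (p : Plane) {T : ℝ → ℝ} (hT : Continuous T)
    (hU : ∀ s t, p + Λ (s, t) ∈ U → (p + Λ (s, t) ∈ Ω ↔ T s < t)) :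
    ∃ C : ℝ≥0, ∀ f : Plane → ℂ, ContDiff ℝ ∞ f → HasCompactSupport f → tsupport f ⊆ U →
      ‖∫ x in Ω, fderiv ℝ f x (Λ (0, 1))‖ₑ ≤ C * ∫⁻ x, ‖f x‖ₑ ∂boundaryMeasure Ω := by
  obtain ⟨c, -, hc⟩ := exists_integral_eq_smul_integral_comp Λ p
  let π : Plane → ℝ := fun x => (Λ.symm (x - p)).1
  obtain ⟨K, hπ⟩ : ∃ K, LipschitzWith K π :=
    ⟨_, (LipschitzWith.prod_fst.comp (Λ.symm.lipschitz)).comp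
      (LipschitzWith.id.sub (LipschitzWith.const p))⟩
  let γ : ℝ → Plane := fun s => p + Λ (s, T s)
  have hγ : Continuous γ := by fun_prop
  have hl : Function.LeftInverse π γ := fun s => by simp [π, γ]
  have hfr : ∀ s, γ s ∈ U → γ s ∈ frontier Ω := by
    intro s hs
    have h1 : γ s ∉ Ω := fun h => by
      simpa using (hU s (T s) hs).1 h
    rw [hΩ.frontier_eq]
    refine ⟨?_, h1⟩
    have hcont : Tendsto (fun t => p + Λ (s, t)) (𝓝[>] (T s)) (𝓝 (γ s)) :=
      (Continuous.tendsto (by fun_prop : Continuous fun t => p + Λ (s, t)) (T s)).mono_left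
        nhdsWithin_le_nhds
    refine mem_closure_of_tendsto hcont ?_
    filter_upwards [hcont.eventually (hUo.mem_nhds hs), self_mem_nhdsWithin]
      with t ht ht'
    exact (hU s t ht).2 ht'
  refine ⟨c * K, fun f hf hfc hfU => ?_⟩
  set F : Plane → ℂ := fun x => fderiv ℝ f x (Λ (0, 1)) with hF
  have hFc : Continuous F := (hf.continuous_fderiv (by simp)).clm_apply continuous_const
  have hFs : HasCompactSupport F := hfc.fderiv_apply ℝ _
  have hF0 : ∀ x, x ∉ U → F x = 0 := fun x hx => by
    have : fderiv ℝ f x = 0 := by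
      by_contra h
      exact hx (hfU (support_fderiv_subset ℝ h))
    simp [hF, this]
  let Ψ : (ℝ × ℝ) ≃ₜ Plane := Λ.toHomeomorph.trans (Homeomorph.addLeft p)
  have hΨ : ∀ z, Ψ z = p + Λ z := fun z => rfl
  have hS : MeasurableSet {z : ℝ × ℝ | T z.1 < z.2} :=
    (isOpen_lt (hT.comp continuous_fst) continuous_snd).measurableSet
  have hint : Integrable ({z : ℝ × ℝ | T z.1 < z.2}.indicator fun z => F (p + Λ z)) :=
    ((hFc.comp Ψ.continuous).integrable_of_hasCompactSupport
      (hFs.comp_homeomorph Ψ)).indicator hS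
  -- Off `U` both sides vanish, so `Ω` may be replaced by the full epigraph. There Fubini and the
  -- fundamental theorem of calculus on each half-line leave only the value of `f` on the graph.
  have hind : ∀ z : ℝ × ℝ, Ω.indicator F (p + Λ z) =
      {z : ℝ × ℝ | T z.1 < z.2}.indicator (fun z => F (p + Λ z)) z := by
    intro z
    by_cases hz : p + Λ z ∈ U
    · have := hU z.1 z.2 hz
      by_cases h : T z.1 < z.2
      · rw [Set.indicator_of_mem (this.2 h), Set.indicator_of_mem (by exact h)]
      · rw [Set.indicator_of_notMem (fun h' => h (this.1 h')),
          Set.indicator_of_notMem (by exact h)]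
    · simp only [Set.indicator]
      simp [hF0 _ hz]
  have hinner : ∀ s, ∫ t, {z : ℝ × ℝ | T z.1 < z.2}.indicator (fun z => F (p + Λ z)) (s, t)
      = - f (γ s) := by
    intro s
    have he : (fun t => {z : ℝ × ℝ | T z.1 < z.2}.indicator (fun z => F (p + Λ z)) (s, t)) =
        (Set.Ioi (T s)).indicator (deriv fun t => f (p + Λ (s, t))) := by
      funext t
      have hd : HasDerivAt (fun t => f (p + Λ (s, t))) (F (p + Λ (s, t))) t := by
        have h1 : HasDerivAt (fun t : ℝ => p + Λ (s, t)) (Λ (0, 1)) t := by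
          have h2 : HasDerivAt (fun t : ℝ => (s, t)) ((0 : ℝ), (1 : ℝ)) t :=
            (hasDerivAt_const t s).prodMk (hasDerivAt_id t)
          exact (Λ.hasFDerivAt.comp_hasDerivAt t h2).const_add p
        exact ((hf.differentiable (by simp)) _).hasFDerivAt.comp_hasDerivAt t h1
      simp [Set.indicator, hd.deriv]
    rw [he, integral_indicator measurableSet_Ioi]
    have hemb : Topology.IsClosedEmbedding fun t : ℝ => Ψ (s, t) := by
      refine Ψ.isClosedEmbedding.comp ?_
      exact Topology.IsClosedEmbedding.of_continuous_injective_isClosedMap (by fun_prop)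
        (fun a b h => (Prod.ext_iff.1 h).2) (isClosedMap_prodMk_left s)
    have hsmooth : ContDiff ℝ 1 fun t : ℝ => f (p + Λ (s, t)) :=
      (hf.of_le (by simp)).comp (contDiff_const.add
        (Λ.contDiff.comp (contDiff_const.prodMk contDiff_id)))
    exact HasCompactSupport.integral_Ioi_deriv_eq hsmooth (hfc.comp_isClosedEmbedding hemb) (T s)
  have hval : ∫ x in Ω, F x = (c : ℝ) • ∫ s, - f (γ s) := by
    rw [← integral_indicator hΩ.measurableSet, hc]
    simp only [hind]
    rw [Measure.volume_eq_prod] at hint ⊢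
    rw [integral_prod _ hint]
    simp only [hinner]
  have hmeas : Measurable fun x => ‖f x‖ₑ := hf.continuous.enorm.measurable
  have h0 : ∫⁻ s, ‖f (γ s)‖ₑ = ∫⁻ x, ‖f x‖ₑ ∂Measure.map γ
      (volume.restrict (γ ⁻¹' frontier Ω)) := by
    rw [lintegral_map hmeas hγ.measurable,
      ← lintegral_indicator (isClosed_frontier.preimage hγ).measurableSet]
    congr 1 with s
    by_cases hs : γ s ∈ frontier Ω
    · rw [Set.indicator_of_mem (by exact hs)]
    · rw [Set.indicator_of_notMem (by exact hs)]
      have : f (γ s) = 0 := image_eq_zero_of_notMem_tsupport fun h => hs (hfr s (hfU h))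
      simp [this]
  rw [hval, enorm_smul]
  calc ‖(c : ℝ)‖ₑ * ‖∫ s, - f (γ s)‖ₑ ≤ c * ∫⁻ s, ‖f (γ s)‖ₑ := by
        gcongr
        · simp [enorm_eq_nnnorm]
        · simpa using enorm_integral_le_lintegral_enorm fun s => - f (γ s)
    _ ≤ c * ∫⁻ x, ‖f x‖ₑ ∂(K • boundaryMeasure Ω) := by
        rw [h0]
        gcongr
        exact map_restrict_le_smul_boundaryMeasure hγ hπ hl
    _ = _ := by
        rw [lintegral_smul_measure, ENNReal.smul_def, smul_eq_mul]
        push_cast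
        ring

/-- A Lipschitz graph is also a graph in every sufficiently steep direction. -/
theorem exists_continuous_lt_iff_of_lipschitzWith {K : ℝ≥0} {γ : ℝ → ℝ} (hγ : LipschitzWith K γ)
    {d : ℝ} (hd : K * |d| ≤ 1 / 2) :
    ∃ T : ℝ → ℝ, Continuous T ∧ ∀ s t, γ (s + t * d) < t ↔ T s < t := by
  have hlip : ∀ x y, |γ x - γ y| ≤ K * |x - y| := fun x y => by
    simpa [Real.dist_eq] using hγ.dist_le_mul x y
  -- The factor `1/2` makes `t ↦ t - γ (s + t d)` strictly increasing; `T s` will be its only zero.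
  have hlip' : ∀ s t t', |γ (s + t * d) - γ (s + t' * d)| ≤ |t - t'| / 2 := fun s t t' => by
    refine (hlip _ _).trans ?_
    have : s + t * d - (s + t' * d) = d * (t - t') := by ring
    rw [this, abs_mul, ← mul_assoc]
    nlinarith [abs_nonneg (t - t')]
  have hex : ∀ s, ∃ t, γ (s + t * d) = t := by
    intro s
    have hc : Continuous fun t => t - γ (s + t * d) := by
      have := hγ.continuous
      fun_prop
    -- Between `0` and `±M` the graph function changes by at most `M / 2 = |γ s|`, so `|γ (s ± M d)|
    -- ≤ M` and the sign changes on `[-M, M]`.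
    set M := 2 * |γ s| with hM
    have hM0 : 0 ≤ M := by positivity
    have h1 := abs_le.1 (hlip' s M 0)
    have h2 := abs_le.1 (hlip' s (-M) 0)
    have h3 := abs_le.1 (le_refl |γ s|)
    simp only [zero_mul, add_zero, sub_zero, abs_neg, abs_of_nonneg hM0] at h1 h2
    obtain ⟨t, -, ht⟩ := intermediate_value_Icc (by linarith : -M ≤ M) hc.continuousOn
      (⟨by linarith [h2.1], by linarith [h1.2]⟩ :
        (0 : ℝ) ∈ Set.Icc (-M - γ (s + -M * d)) (M - γ (s + M * d)))
    exact ⟨t, by simp only at ht; linarith⟩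
  choose T hT using hex
  refine ⟨T, ?_, fun s t => ?_⟩
  -- From `|T s - T s'| ≤ |T s - T s'| / 2 + K |s - s'|`, absorbing the first term.
  · have : LipschitzWith (2 * K) T := LipschitzWith.of_dist_le_mul fun s s' => by
      simp only [Real.dist_eq, NNReal.coe_mul, NNReal.coe_ofNat]
      have h1 := hlip' s (T s) (T s')
      have h2 := hlip (s + T s' * d) (s' + T s' * d)
      have h3 : T s - T s' = (γ (s + T s * d) - γ (s + T s' * d)) +
          (γ (s + T s' * d) - γ (s' + T s' * d)) := by rw [hT s, hT s']; ring
      have h4 := abs_add_le (γ (s + T s * d) - γ (s + T s' * d))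
          (γ (s + T s' * d) - γ (s' + T s' * d))
      rw [← h3] at h4
      have h5 : s + T s' * d - (s' + T s' * d) = s - s' := by ring
      rw [h5] at h2
      linarith
    exact this.continuous
  · have h1 := abs_le.1 (hlip' s t (T s))
    rw [hT s] at h1
    constructor
    · intro h
      by_contra! h'
      rw [abs_of_nonpos (by linarith)] at h1
      linarith
    · intro h
      rw [abs_of_nonneg (by linarith)] at h1
      linarith

theorem linearIndependent_single_shear (e : Plane ≃ₗᵢ[ℝ] Plane) (d : ℝ) :
    LinearIndependent ℝ ![e (EuclideanSpace.single 0 1),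
      e (d • EuclideanSpace.single 0 1 + EuclideanSpace.single 1 1)] := by
  refine LinearIndependent.pair_iff.2 fun s t h => ?_
  rw [← map_smul, ← map_smul, ← map_add] at h
  have h := (map_eq_zero_iff e e.injective).1 h
  have h0 := congrArg (fun x : Plane => x 0) h
  have h1 := congrArg (fun x : Plane => x 1) h
  simp at h0 h1
  subst h1
  simpa using h0

theorem integrableOn_fderiv_apply {f : Plane → ℂ} (hf : ContDiff ℝ ∞ f) (hfc : HasCompactSupport f)
    (v : Plane) (s : Set Plane) : IntegrableOn (fun x => fderiv ℝ f x v) s :=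
  (((hf.continuous_fderiv (by simp)).clm_apply continuous_const).integrable_of_hasCompactSupport
    (hfc.fderiv_apply ℝ _)).integrableOn

/-- A chart controls derivatives in its vertical direction. The same set is an epigraph in a
slightly tilted direction as well, and the two directions span the plane. -/
theorem IsBoundedLipschitzDomain.exists_enorm_setIntegral_le_of_mem_frontier {Ω : Set Plane}
    (hΩ : IsBoundedLipschitzDomain Ω) {p : Plane} (hp : p ∈ frontier Ω) :
    ∃ (U : Set Plane) (C : ℝ≥0), IsOpen U ∧ p ∈ U ∧ ∀ f : Plane → ℂ, ContDiff ℝ ∞ f →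
      HasCompactSupport f → tsupport f ⊆ U → ∀ i, ‖∫ x in Ω, partialDeriv i f x‖ₑ ≤
        C * ∫⁻ x, ‖f x‖ₑ ∂boundaryMeasure Ω := by
  obtain ⟨e, K, γ, U, hγ, hU, hUΩ⟩ := hΩ.lipschitz_boundary p hp
  set L := e.symm.linearIsometryEquiv with hL
  let E : Fin 2 → Plane := fun i => EuclideanSpace.single i 1
  have key : ∀ d : ℝ, K * |d| ≤ 1 / 2 → ∃ C : ℝ≥0, ∀ f : Plane → ℂ, ContDiff ℝ ∞ f →
      HasCompactSupport f → tsupport f ⊆ interior U →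
      ‖∫ x in Ω, fderiv ℝ f x (L (d • E 0 + E 1))‖ₑ ≤ C * ∫⁻ x, ‖f x‖ₑ ∂boundaryMeasure Ω := by
    intro d hd
    obtain ⟨T, hTc, hT⟩ := exists_continuous_lt_iff_of_lipschitzWith hγ hd
    obtain ⟨Λ, hΛ⟩ := exists_continuousLinearEquiv_of_linearIndependent
      (linearIndependent_single_shear L d)
    have he : ∀ s t, e (e.symm 0 + Λ (s, t)) = s • E 0 + t • (d • E 0 + E 1) := by
      intro s t
      rw [hΛ, ← map_smul, ← map_smul, ← map_add, add_comm, ← vadd_eq_add]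
      have h1 := e.symm.map_vadd (0 : Plane) (s • E 0 + t • (d • E 0 + E 1))
      rw [← hL] at h1
      rw [← h1]
      simp
    have := exists_enorm_setIntegral_fderiv_le_of_epigraph hΩ.isOpen isOpen_interior Λ (e.symm 0)
      hTc (U := interior U) fun s t hst => by
        rw [hUΩ _ (interior_subset hst), he, ← hT]
        simp [E]
    simpa [hΛ] using this
  obtain ⟨C₀, h₀⟩ := key 0 (by simp)
  -- The tilt satisfies `K ε ≤ 1/2`; the summand `1` covers `K = 0`.
  set ε : ℝ := 1 / (2 * (K + 1)) with hε
  have hε0 : 0 < ε := by positivity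
  obtain ⟨C₁, h₁⟩ := key ε (by
    rw [abs_of_pos hε0, hε, mul_one_div, div_le_div_iff₀ (by positivity) (by norm_num)]
    linarith [K.2])
  set b₀ := L ((0 : ℝ) • E 0 + E 1)
  set b₁ := L (ε • E 0 + E 1)
  have hspan : ∀ v : Plane, ∃ α β : ℝ, v = α • b₀ + β • b₁ := by
    intro v
    set w := L.symm v with hw
    refine ⟨w 1 - w 0 / ε, w 0 / ε, ?_⟩
    rw [← map_smul, ← map_smul, ← map_add, ← L.symm_apply_eq, ← hw]
    ext i
    fin_cases i
    · simp [E]; field_simp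
    · simp [E]
  choose α β hαβ using fun i => hspan (E i)
  refine ⟨interior U, ∑ i, (‖α i‖₊ * C₀ + ‖β i‖₊ * C₁), isOpen_interior,
    mem_interior_iff_mem_nhds.2 hU, fun f hf hfc hfU i => ?_⟩
  have hsplit : ∫ x in Ω, partialDeriv i f x =
      α i • (∫ x in Ω, fderiv ℝ f x b₀) + β i • ∫ x in Ω, fderiv ℝ f x b₁ := by
    rw [← integral_smul, ← integral_smul, ← integral_add
      (by exact (integrableOn_fderiv_apply hf hfc _ _).smul (α i))
      (by exact (integrableOn_fderiv_apply hf hfc _ _).smul (β i))]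
    congr 1 with x
    rw [partialDeriv, show EuclideanSpace.single i (1 : ℝ) = E i from rfl, hαβ i]
    simp only [map_add, map_smul]
  set I := ∫⁻ x, ‖f x‖ₑ ∂boundaryMeasure Ω
  calc ‖∫ x in Ω, partialDeriv i f x‖ₑ
      ≤ ‖α i‖ₑ * (C₀ * I) + ‖β i‖ₑ * (C₁ * I) := by
        rw [hsplit]
        refine (enorm_add_le _ _).trans ?_
        rw [enorm_smul, enorm_smul]
        gcongr
        · exact h₀ f hf hfc hfU
        · exact h₁ f hf hfc hfU
    _ = ((‖α i‖₊ * C₀ + ‖β i‖₊ * C₁ : ℝ≥0) : ENNReal) * I := by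
        push_cast
        simp only [enorm_eq_nnnorm]
        ring
    _ ≤ _ := by
        gcongr
        exact Finset.single_le_sum (f := fun i => ‖α i‖₊ * C₀ + ‖β i‖₊ * C₁)
          (fun _ _ => zero_le) (Finset.mem_univ i)

theorem setIntegral_fderiv_eq_zero {Ω : Set Plane} {f : Plane → ℂ} (hf : ContDiff ℝ ∞ f)
    (hfc : HasCompactSupport f) (hfΩ : tsupport f ⊆ Ω) (v : Plane) :
    ∫ x in Ω, fderiv ℝ f x v = 0 := by
  rw [setIntegral_eq_integral_of_forall_compl_eq_zero]
  · have h := integral_mul_fderiv_eq_neg_fderiv_mul_of_integrable (μ := (volume : Measure Plane))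
      (f := fun _ => (1 : ℂ)) (g := f) (v := v) (by simp)
      (by simpa using (integrableOn_fderiv_apply hf hfc v Set.univ))
      (by simpa using hf.continuous.integrable_of_hasCompactSupport hfc) (by simp)
      (fun x _ => (hf.differentiable (by simp)) x)
    simpa using h
  · intro x hx
    have : fderiv ℝ f x = 0 := by
      by_contra h
      exact hx (hfΩ (support_fderiv_subset ℝ h))
    simp [this]

theorem IsBoundedLipschitzDomain.isCompact_closure {Ω : Set Plane}
    (hΩ : IsBoundedLipschitzDomain Ω) : IsCompact (closure Ω) :=
  hΩ.isBounded.isCompact_closure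

/-- On a bounded Lipschitz domain the integral of a partial derivative of a smooth function is
controlled by the integral of the function over the boundary. -/
theorem IsBoundedLipschitzDomain.exists_enorm_setIntegral_partialDeriv_le {Ω : Set Plane}
    (hΩ : IsBoundedLipschitzDomain Ω) :
    ∃ C : ℝ≥0, ∀ f : Plane → ℂ, ContDiff ℝ ∞ f → ∀ i, ‖∫ x in Ω, partialDeriv i f x‖ₑ ≤
      C * ∫⁻ x, ‖f x‖ₑ ∂boundaryMeasure Ω := by
  have hloc : ∀ p ∈ closure Ω, ∃ (U : Set Plane) (C : ℝ≥0), IsOpen U ∧ p ∈ U ∧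
      ∀ f : Plane → ℂ, ContDiff ℝ ∞ f → HasCompactSupport f → tsupport f ⊆ U →
        ∀ i, ‖∫ x in Ω, partialDeriv i f x‖ₑ ≤ C * ∫⁻ x, ‖f x‖ₑ ∂boundaryMeasure Ω := by
    intro p hp
    by_cases hpΩ : p ∈ Ω
    · refine ⟨Ω, 0, hΩ.isOpen, hpΩ, fun f hf hfc hfΩ i => ?_⟩
      have := setIntegral_fderiv_eq_zero hf hfc hfΩ (EuclideanSpace.single i (1 : ℝ))
      simp only [partialDeriv]
      simp [this]
    · exact hΩ.exists_enorm_setIntegral_le_of_mem_frontier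
        (by rw [hΩ.isOpen.frontier_eq]; exact ⟨hp, hpΩ⟩)
  choose! U C hUo hpU hUC using hloc
  obtain ⟨t, ht, hcov⟩ := hΩ.isCompact_closure.elim_nhds_subcover U
    fun x hx => (hUo x hx).mem_nhds (hpU x hx)
  -- Intersecting the cover with a ball gives the partition functions compact support.
  obtain ⟨R, hR⟩ := hΩ.isBounded.closure.subset_ball 0
  obtain ⟨χ, hχ⟩ := SmoothPartitionOfUnity.exists_isSubordinate
    (modelWithCornersSelf ℝ Plane) (isClosed_closure (s := Ω))
    (fun x : t => U x ∩ Metric.ball 0 R)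
    (fun x => (hUo x (ht x x.2)).inter Metric.isOpen_ball)
    (fun x hx => by
      obtain ⟨y, hy, hxy⟩ := Set.mem_iUnion₂.1 (hcov hx)
      exact Set.mem_iUnion.2 ⟨⟨y, hy⟩, hxy, hR hx⟩)
  refine ⟨∑ x : t, C x, fun f hf i => ?_⟩
  let g : t → Plane → ℂ := fun j x => (χ j x : ℂ) * f x
  have hg : ∀ j, ContDiff ℝ ∞ (g j) := fun j =>
    (Complex.ofRealCLM.contDiff.comp (χ j).contMDiff.contDiff).mul hf
  have hgs : ∀ j, tsupport (g j) ⊆ U j ∩ Metric.ball 0 R := fun j => by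
    refine subset_trans (closure_mono fun x hx => ?_) (hχ j)
    simp only [g, Function.mem_support] at hx ⊢
    intro h
    simp [h] at hx
  have hgc : ∀ j, HasCompactSupport (g j) := fun j =>
    (isCompact_closedBall (0 : Plane) R).of_isClosed_subset (isClosed_tsupport _)
      (((hgs j).trans Set.inter_subset_right).trans Metric.ball_subset_closedBall)
  have hsum : ∀ x ∈ Ω, f x = ∑ j, g j x := fun x hx => by
    have h1 := χ.sum_eq_one (subset_closure hx)
    rw [finsum_eq_sum_of_fintype] at h1
    simp only [g]
    rw [← Finset.sum_mul, ← Complex.ofReal_sum, h1]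
    simp
  have hderiv : ∀ x ∈ Ω, partialDeriv i f x = ∑ j, partialDeriv i (g j) x := fun x hx => by
    have h1 : f =ᶠ[𝓝 x] fun y => ∑ j, g j y := by
      filter_upwards [hΩ.isOpen.mem_nhds hx] with y hy using hsum y hy
    simp only [partialDeriv]
    rw [h1.fderiv_eq, fderiv_fun_sum fun j _ => (hg j).differentiable (by simp) x]
    simp
  rw [setIntegral_congr_fun hΩ.isOpen.measurableSet hderiv,
    integral_finsetSum _ fun j _ => by exact integrableOn_fderiv_apply (hg j) (hgc j) _ _]
  calc _ ≤ ∑ j, ‖∫ x in Ω, partialDeriv i (g j) x‖ₑ := enorm_sum_le _ _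
    _ ≤ ∑ j : t, (C j : ENNReal) * ∫⁻ x, ‖f x‖ₑ ∂boundaryMeasure Ω := by
        refine Finset.sum_le_sum fun j _ => ?_
        refine (hUC j (ht j j.2) (g j) (hg j) (hgc j)
          ((hgs j).trans Set.inter_subset_left) i).trans ?_
        gcongr with x
        simp only [g]
        rw [enorm_mul]
        refine mul_le_of_le_one_left zero_le ?_
        rw [← ofReal_norm, Complex.norm_real, Real.norm_of_nonneg (χ.nonneg j x)]
        exact ENNReal.ofReal_le_one.2 (χ.le_one j x)
    _ = _ := by
        rw [← Finset.sum_mul]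
        push_cast
        rfl

/-- Locally the boundary lies in a Lipschitz image of a bounded interval, and it is compact.
Finiteness puts continuous functions in `L²(∂Ω)`, so the exponentials have traces. -/
theorem IsBoundedLipschitzDomain.isFiniteMeasure_boundaryMeasure {Ω : Set Plane}
    (hΩ : IsBoundedLipschitzDomain Ω) : IsFiniteMeasure (boundaryMeasure Ω) := by
  refine ⟨?_⟩
  rw [Measure.restrict_apply_univ]
  refine (hΩ.isCompact_closure.of_isClosed_subset isClosed_frontier
    frontier_subset_closure).measure_lt_top_of_nhdsWithin fun p hp => ?_
  obtain ⟨e, K, γ, U, hγ, hU, hUΩ⟩ := hΩ.lipschitz_boundary p hp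
  have hgraph : ∀ x ∈ interior U, x ∈ frontier Ω → e x 1 = γ (e x 0) := by
    intro x hx hxΩ
    have hc0 : Continuous fun x : Plane => e x 0 :=
      (EuclideanSpace.proj (𝕜 := ℝ) (0 : Fin 2)).continuous.comp e.continuous
    have hc1 : Continuous fun x : Plane => e x 1 :=
      (EuclideanSpace.proj (𝕜 := ℝ) (1 : Fin 2)).continuous.comp e.continuous
    rw [hΩ.isOpen.frontier_eq] at hxΩ
    refine le_antisymm (not_lt.1 fun h => hxΩ.2 ((hUΩ x (interior_subset hx)).2 h))
      (not_lt.1 fun h => ?_)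
    have hV : interior U ∩ {x | e x 1 < γ (e x 0)} ∈ 𝓝 x :=
      (isOpen_interior.inter (isOpen_lt hc1 (hγ.continuous.comp hc0))).mem_nhds ⟨hx, h⟩
    obtain ⟨y, hy, hyΩ⟩ := mem_closure_iff_nhds.1 hxΩ.1 _ hV
    have := (hUΩ y (interior_subset hy.1)).1 hyΩ
    exact lt_asymm this hy.2
  let G : ℝ → Plane := fun s => e.symm (!₂[s, γ s])
  obtain ⟨KG, hG⟩ : ∃ KG, LipschitzWith KG G := by
    refine ⟨_, e.symm.lipschitz.comp ((PiLp.lipschitzWith_toLp 2 (fun _ : Fin 2 => ℝ)).comp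
      (LipschitzWith.of_dist_le_mul (K := max 1 K) fun s s' => ?_))⟩
    rw [dist_pi_le_iff (by positivity)]
    intro i
    fin_cases i
    · simp only [Fin.zero_eta, Matrix.cons_val_zero]
      exact le_mul_of_one_le_left dist_nonneg (by simp)
    · simp only [Fin.mk_one, Matrix.cons_val_one, Matrix.cons_val_fin_one]
      refine (hγ.dist_le_mul s s').trans ?_
      gcongr
      simp
  have hsub : interior U ∩ Metric.ball p 1 ∩ frontier Ω ⊆
      G '' Metric.closedBall (e p 0) 1 := by
    rintro x ⟨⟨hxU, hxp⟩, hxΩ⟩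
    refine ⟨e x 0, ?_, ?_⟩
    · rw [Metric.mem_closedBall]
      refine le_trans ?_ (Metric.mem_ball.1 hxp).le
      rw [← e.dist_map x p]
      rw [EuclideanSpace.dist_eq]
      refine Real.le_sqrt_of_sq_le ?_
      exact Finset.single_le_sum (f := fun i => dist (e x i) (e p i) ^ 2)
        (fun _ _ => sq_nonneg _) (Finset.mem_univ 0)
    · simp only [G]
      rw [e.symm_apply_eq, ← hgraph x hxU hxΩ]
      ext i
      fin_cases i <;> simp
  refine ⟨interior U ∩ Metric.ball p 1 ∩ frontier Ω, ?_, ?_⟩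
  · exact inter_mem (mem_nhdsWithin_of_mem_nhds (inter_mem (interior_mem_nhds.2 hU)
      (Metric.ball_mem_nhds p one_pos))) self_mem_nhdsWithin
  · refine (measure_mono hsub).trans_lt ((hG.hausdorffMeasure_image_le zero_le_one _).trans_lt ?_)
    rw [hausdorffMeasure_real]
    refine ENNReal.mul_lt_top (by simp) ?_
    exact measure_closedBall_lt_top

/-! ### Green's formula and exponential solutions -/

theorem tendsto_integral_mul_of_tendsto_eLpNorm {μ : Measure Plane} {a : ℕ → Plane → ℂ}
    {a' b : Plane → ℂ} (ha : ∀ n, AEStronglyMeasurable (a n) μ) (ha' : MemLp a' 2 μ)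
    (hb : MemLp b 2 μ) (h : Tendsto (fun n => eLpNorm (fun x => a n x - a' x) 2 μ) atTop (𝓝 0)) :
    Tendsto (fun n => ∫ x, a n x * b x ∂μ) atTop (𝓝 (∫ x, a' x * b x ∂μ)) := by
  -- The `a n` are only measurable, but a difference of finite norm is in `L²`, which holds from
  -- some `n` on.
  have hfin : ∀ᶠ n in atTop, MemLp (fun x => a n x - a' x) 2 μ := by
    filter_upwards [h.eventually (gt_mem_nhds ENNReal.zero_lt_top)] with n hn
    exact ⟨(ha n).sub ha'.1, hn⟩
  refine tendsto_integral_of_L1' _ (ha'.integrable_mul hb).1 ?_ ?_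
  · filter_upwards [hfin] with n hn
    have := (hn.integrable_mul hb).add (ha'.integrable_mul hb)
    refine this.congr (Eventually.of_forall fun x => ?_)
    simp only [Pi.add_apply, Pi.mul_apply]
    ring
  · have h2 := ENNReal.Tendsto.mul_const h (Or.inr hb.2.ne : (0 : ENNReal) ≠ 0 ∨ eLpNorm b 2 μ ≠ ⊤)
    rw [zero_mul] at h2
    refine tendsto_of_tendsto_of_tendsto_of_le_of_le tendsto_const_nhds h2 (fun _ => zero_le)
      fun n => ?_
    have := eLpNorm_smul_le_mul_eLpNorm (p := 2) (q := 2) (r := 1) hb.1 ((ha n).sub ha'.1)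
    refine le_trans (le_of_eq ?_) this
    congr 1
    ext x
    simp only [Pi.sub_apply, Pi.smul_apply', smul_eq_mul, Pi.mul_apply]
    ring

theorem memLp_restrict_of_continuous_of_isBounded {s : Set Plane} {μ : Measure Plane}
    [IsFiniteMeasure (μ.restrict s)] (hs : MeasurableSet s) (hb : Bornology.IsBounded s)
    {φ : Plane → ℂ} (hφ : Continuous φ) : MemLp φ 2 (μ.restrict s) := by
  obtain ⟨M, hM⟩ := hb.isCompact_closure.exists_bound_of_continuousOn hφ.continuousOn
  exact MemLp.of_bound hφ.aestronglyMeasurable M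
    ((ae_restrict_iff' hs).2 (Eventually.of_forall fun x hx => hM x (subset_closure hx)))

theorem IsBoundedLipschitzDomain.memLp_of_continuous {Ω : Set Plane}
    (hΩ : IsBoundedLipschitzDomain Ω) {φ : Plane → ℂ} (hφ : Continuous φ) :
    MemLp φ 2 (volume.restrict Ω) := by
  have : IsFiniteMeasure (volume.restrict Ω) := ⟨by
    simpa using hΩ.isBounded.measure_lt_top⟩
  exact memLp_restrict_of_continuous_of_isBounded hΩ.isOpen.measurableSet hΩ.isBounded hφ

theorem IsBoundedLipschitzDomain.memLp_boundaryMeasure_of_continuous {Ω : Set Plane}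
    (hΩ : IsBoundedLipschitzDomain Ω) {φ : Plane → ℂ} (hφ : Continuous φ) :
    MemLp φ 2 (boundaryMeasure Ω) := by
  have := hΩ.isFiniteMeasure_boundaryMeasure
  exact memLp_restrict_of_continuous_of_isBounded isClosed_frontier.measurableSet
    (hΩ.isBounded.closure.subset frontier_subset_closure) hφ

/-- The restriction of a smooth function to a bounded domain, as an element of `H¹`. -/
noncomputable def H1.ofSmooth {Ω : Set Plane} (hΩ : IsBoundedLipschitzDomain Ω) (φ : Plane → ℂ)
    (hφ : ContDiff ℝ ∞ φ) : H1 Ω where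
  toFun := φ
  grad := fun i => partialDeriv i φ
  memLp := hΩ.memLp_of_continuous hφ.continuous
  grad_memLp := fun i => hΩ.memLp_of_continuous (continuous_partialDeriv hφ i)
  weak_deriv := by
    intro i ψ hψ
    have hψc := hψ.contDiff.continuous
    have hψd : HasCompactSupport (partialDeriv i ψ) := hψ.hasCompactSupport.fderiv_apply ℝ _
    have h0 : ∀ x, x ∉ Ω → ψ x = 0 ∧ partialDeriv i ψ x = 0 := fun x hx => by
      refine ⟨image_eq_zero_of_notMem_tsupport fun h => hx (hψ.tsupport_subset h), ?_⟩
      have : fderiv ℝ ψ x = 0 := by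
        by_contra h
        exact hx (hψ.tsupport_subset (support_fderiv_subset ℝ h))
      simp [partialDeriv, this]
    rw [setIntegral_eq_integral_of_forall_compl_eq_zero fun x hx => by rw [(h0 x hx).2, mul_zero],
      setIntegral_eq_integral_of_forall_compl_eq_zero fun x hx => by rw [(h0 x hx).1, mul_zero]]
    exact integral_mul_fderiv_eq_neg_fderiv_mul_of_integrable
      (((continuous_partialDeriv hφ i).mul hψc).integrable_of_hasCompactSupport
        hψ.hasCompactSupport.mul_left)
      ((hφ.continuous.mul (continuous_partialDeriv hψ.contDiff i)).integrable_of_hasCompactSupport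
        hψd.mul_left)
      ((hφ.continuous.mul hψc).integrable_of_hasCompactSupport hψ.hasCompactSupport.mul_left)
      (fun x _ => hφ.differentiable (by simp) x)
      (fun x _ => hψ.contDiff.differentiable (by simp) x)

theorem isTrace_ofSmooth {Ω : Set Plane} (hΩ : IsBoundedLipschitzDomain Ω) {φ : Plane → ℂ}
    (hφ : ContDiff ℝ ∞ φ) : IsTrace (H1.ofSmooth hΩ φ hφ)
      (hΩ.memLp_boundaryMeasure_of_continuous hφ.continuous).toLp := by
  refine ⟨fun _ => φ, fun _ => hφ, ⟨?_, fun i => ?_⟩, ?_⟩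
  · simp [H1.ofSmooth]
  · simp [H1.ofSmooth]
  · refine (tendsto_congr fun n => ?_).2 tendsto_const_nhds
    rw [← eLpNorm_zero (ε := ℂ) (p := 2) (μ := boundaryMeasure Ω)]
    apply eLpNorm_congr_ae
    filter_upwards [(hΩ.memLp_boundaryMeasure_of_continuous hφ.continuous).coeFn_toLp] with x hx
    rw [hx]
    simp

/-- The exponential `x ↦ exp (z₀ x₀ + z₁ x₁)` with a complex frequency. -/
noncomputable def expWave (z : Fin 2 → ℂ) (x : Plane) : ℂ := Complex.exp (∑ i, z i * (x i : ℂ))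

theorem contDiff_expWave (z : Fin 2 → ℂ) : ContDiff ℝ ∞ (expWave z) := by
  have h : ∀ i : Fin 2, ContDiff ℝ ∞ fun x : Plane => ((x i : ℝ) : ℂ) := fun i =>
    Complex.ofRealCLM.contDiff.comp (EuclideanSpace.proj (𝕜 := ℝ) i).contDiff
  exact Complex.contDiff_exp.comp (ContDiff.sum fun i _ => contDiff_const.mul (h i))

theorem partialDeriv_expWave (z : Fin 2 → ℂ) (i : Fin 2) (x : Plane) :
    partialDeriv i (expWave z) x = z i * expWave z x := by
  have h : ∀ j : Fin 2, HasFDerivAt (fun x : Plane => ((x j : ℝ) : ℂ))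
      (Complex.ofRealCLM.comp (EuclideanSpace.proj (𝕜 := ℝ) j)) x := fun j =>
    (Complex.ofRealCLM.comp (EuclideanSpace.proj (𝕜 := ℝ) j)).hasFDerivAt
  have h2 := (HasFDerivAt.fun_sum (u := Finset.univ) fun j _ => (h j).const_mul (z j)).cexp
  rw [partialDeriv, show expWave z = fun x => Complex.exp (∑ i, z i * (x i : ℂ)) from rfl,
    h2.fderiv]
  fin_cases i <;> simp [mul_comm]

theorem partialDeriv_mul {φ ψ : Plane → ℂ} (hφ : ContDiff ℝ ∞ φ) (hψ : ContDiff ℝ ∞ ψ)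
    (i : Fin 2) (x : Plane) :
    partialDeriv i (fun y => φ y * ψ y) x =
      partialDeriv i φ x * ψ x + φ x * partialDeriv i ψ x := by
  simp only [partialDeriv]
  rw [fderiv_fun_mul (hφ.differentiable (by simp) x) (hψ.differentiable (by simp) x)]
  simp
  ring

/-- A function with zero trace is orthogonal to the exponential solutions of the Helmholtz equation
in the sense of the bilinear form. -/
theorem helmholtzForm_expWave_eq_zero {Ω : Set Plane} (hΩ : IsBoundedLipschitzDomain Ω) {k : ℝ}
    {z : Fin 2 → ℂ} (hz : ∑ i, z i ^ 2 = -(k : ℂ) ^ 2) {u : H1 Ω} (hu : IsTrace u 0) :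
    helmholtzForm k u (H1.ofSmooth hΩ (expWave z) (contDiff_expWave z)) = 0 := by
  obtain ⟨φ, hφ, ⟨hφ0, hφ1⟩, hφb⟩ := hu
  set w := expWave z with hw
  have hws : ContDiff ℝ ∞ w := contDiff_expWave z
  have hwL := hΩ.memLp_of_continuous hws.continuous
  have hwb := hΩ.memLp_boundaryMeasure_of_continuous hws.continuous
  have hL : ∀ {ψ : Plane → ℂ}, Continuous ψ → MemLp ψ 2 (volume.restrict Ω) :=
    fun h => hΩ.memLp_of_continuous h
  have hpd : ∀ i, Continuous (partialDeriv i w) := continuous_partialDeriv hws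
  have h1 : ∀ i, Tendsto (fun n => ∫ x in Ω, partialDeriv i (φ n) x * partialDeriv i w x) atTop
      (𝓝 (∫ x in Ω, u.grad i x * partialDeriv i w x)) := fun i =>
    tendsto_integral_mul_of_tendsto_eLpNorm
      (fun n => (continuous_partialDeriv (hφ n) i).aestronglyMeasurable) (u.grad_memLp i)
      (hL (hpd i)) (hφ1 i)
  have h0 : Tendsto (fun n => ∫ x in Ω, φ n x * w x) atTop (𝓝 (∫ x in Ω, u.toFun x * w x)) :=
    tendsto_integral_mul_of_tendsto_eLpNorm
      (fun n => (hφ n).continuous.aestronglyMeasurable) u.memLp hwL hφ0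
  have hlim := (tendsto_finsetSum Finset.univ fun i _ => h1 i).sub (h0.const_mul ((k : ℂ) ^ 2))
  have hform : helmholtzForm k u (H1.ofSmooth hΩ w hws) =
      ∑ i, (∫ x in Ω, u.grad i x * partialDeriv i w x) -
        (k : ℂ) ^ 2 * ∫ x in Ω, u.toFun x * w x := by
    simp only [helmholtzForm, H1.ofSmooth]
    rw [integral_finsetSum _ fun i _ => by
      exact (u.grad_memLp i).integrable_mul (hL (hpd i))]
  rw [← hform] at hlim
  refine tendsto_nhds_unique hlim ?_
  -- Since `∂ᵢw = zᵢ w`, the terms without derivatives of `φ n` add up to `z·z φ w = -k² φ w`, and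
  -- the form becomes the integral of a divergence.
  have hgreen : ∀ n, ∑ i, (∫ x in Ω, partialDeriv i (φ n) x * partialDeriv i w x) -
      (k : ℂ) ^ 2 * ∫ x in Ω, φ n x * w x =
      ∑ i, z i * ∫ x in Ω, partialDeriv i (fun y => φ n y * w y) x := by
    intro n
    have hi : ∀ i, z i * (∫ x in Ω, partialDeriv i (fun y => φ n y * w y) x) =
        (∫ x in Ω, partialDeriv i (φ n) x * partialDeriv i w x) +
          z i ^ 2 * ∫ x in Ω, φ n x * w x := by
      intro i
      rw [← integral_const_mul, ← integral_const_mul, ← integral_add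
        (by exact (hL (continuous_partialDeriv (hφ n) i)).integrable_mul (hL (hpd i)))
        (by exact ((hL (hφ n).continuous).integrable_mul hwL).const_mul _)]
      congr 1 with x
      rw [partialDeriv_mul (hφ n) hws, partialDeriv_expWave]
      ring
    rw [Finset.sum_congr rfl fun i _ => hi i, Finset.sum_add_distrib, ← Finset.sum_mul, hz]
    ring
  obtain ⟨C, hC⟩ := hΩ.exists_enorm_setIntegral_partialDeriv_le
  have hb : Tendsto (fun n => ∫⁻ x, ‖φ n x * w x‖ₑ ∂boundaryMeasure Ω) atTop (𝓝 0) := by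
    have hb' : Tendsto (fun n => eLpNorm (φ n) 2 (boundaryMeasure Ω)) atTop (𝓝 0) := by
      refine hφb.congr fun n => eLpNorm_congr_ae ?_
      filter_upwards [Lp.coeFn_zero ℂ 2 (boundaryMeasure Ω)] with x hx
      rw [hx]
      simp
    have h2 := ENNReal.Tendsto.mul_const hb'
      (Or.inr hwb.2.ne : (0 : ENNReal) ≠ 0 ∨ eLpNorm w 2 (boundaryMeasure Ω) ≠ ⊤)
    rw [zero_mul] at h2
    refine tendsto_of_tendsto_of_tendsto_of_le_of_le tendsto_const_nhds h2 (fun _ => zero_le)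
      fun n => ?_
    have := eLpNorm_smul_le_mul_eLpNorm (p := 2) (q := 2) (r := 1) hwb.1
      (hφ n).continuous.aestronglyMeasurable
    rw [eLpNorm_one_eq_lintegral_enorm] at this
    exact this
  have hi0 : ∀ i, Tendsto (fun n => ∫ x in Ω, partialDeriv i (fun y => φ n y * w y) x) atTop
      (𝓝 0) := by
    intro i
    rw [tendsto_zero_iff_enorm_tendsto_zero]
    have h2 := ENNReal.Tendsto.const_mul hb
      (Or.inr (by simp) : (0 : ENNReal) ≠ 0 ∨ (C : ENNReal) ≠ ⊤)
    rw [mul_zero] at h2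
    exact tendsto_of_tendsto_of_tendsto_of_le_of_le tendsto_const_nhds h2 (fun _ => zero_le)
      fun n => hC _ ((hφ n).mul hws) i
  have := tendsto_finsetSum Finset.univ fun i _ => (hi0 i).const_mul (z i)
  simp only [mul_zero, Finset.sum_const_zero] at this
  exact this.congr fun n => (hgreen n).symm

/-- Sources with the same Cauchy data have the same moments against exponential solutions. -/
theorem sourceFunctional_expWave_eq {Ω : Set Plane} (hΩ : IsBoundedLipschitzDomain Ω) {k : ℝ}
    {D₁ D₂ : Set Plane} {ρ₁ ρ₂ : Plane → ℂ} {u₁ u₂ : H1 Ω} {f : HHalf Ω} {N : HHalf Ω →ₗ[ℂ] ℂ}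
    (h₁ : IsCauchyData k (sourceFunctional Ω D₁ ρ₁) u₁ f N)
    (h₂ : IsCauchyData k (sourceFunctional Ω D₂ ρ₂) u₂ f N)
    {z : Fin 2 → ℂ} (hz : ∑ i, z i ^ 2 = -(k : ℂ) ^ 2) :
    ∫ x in D₁, ρ₁ x * expWave z x = ∫ x in D₂, ρ₂ x * expWave z x := by
  set w := H1.ofSmooth hΩ (expWave z) (contDiff_expWave z) with hw
  have htr := isTrace_ofSmooth hΩ (contDiff_expWave z)
  -- Both identities evaluate the common `N` at the trace of `w`; subtracting them leaves the form
  -- of `u₁ - u₂`, which vanishes.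
  have e1 := h₁.2 ⟨_, w, htr⟩ w htr
  have e2 := h₂.2 ⟨_, w, htr⟩ w htr
  have htr0 : IsTrace (u₁.add (u₂.smul (-1))) 0 := by
    have := h₁.1.add (h₂.1.smul (-1))
    rwa [neg_one_smul, add_neg_cancel] at this
  have e3 := helmholtzForm_expWave_eq_zero hΩ hz htr0
  rw [← hw] at e3
  have e4 : helmholtzForm k (u₁.add (u₂.smul (-1))) w =
      helmholtzForm k u₁ w - helmholtzForm k u₂ w := by
    have hi : ∀ u : H1 Ω, Integrable (fun x => ∑ i, u.grad i x * w.grad i x)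
        (volume.restrict Ω) := fun u =>
      integrable_finsetSum _ fun i _ => (u.grad_memLp i).integrable_mul (w.grad_memLp i)
    have hi' : ∀ u : H1 Ω, Integrable (fun x => u.toFun x * w.toFun x)
        (volume.restrict Ω) := fun u => u.memLp.integrable_mul w.memLp
    simp only [helmholtzForm]
    have a1 : ∫ x in Ω, ∑ i, (u₁.add (u₂.smul (-1))).grad i x * w.grad i x =
        (∫ x in Ω, ∑ i, u₁.grad i x * w.grad i x) - ∫ x in Ω, ∑ i, u₂.grad i x * w.grad i x := by
      rw [← integral_sub (hi u₁) (hi u₂)]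
      congr 1 with x
      rw [← Finset.sum_sub_distrib]
      refine Finset.sum_congr rfl fun i _ => ?_
      simp only [H1.add, H1.smul]
      ring
    have a2 : ∫ x in Ω, (u₁.add (u₂.smul (-1))).toFun x * w.toFun x =
        (∫ x in Ω, u₁.toFun x * w.toFun x) - ∫ x in Ω, u₂.toFun x * w.toFun x := by
      rw [← integral_sub (hi' u₁) (hi' u₂)]
      congr 1 with x
      simp only [H1.add, H1.smul]
      ring
    rw [a1, a2]
    ring
  have e5 : sourceFunctional Ω D₁ ρ₁ w = sourceFunctional Ω D₂ ρ₂ w := by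
    linear_combination e2 - e1 + e4 - e3
  exact e5

/-! ### Polygons near an extremal vertex -/

/-- Off its frontier, the space splits into the open sets `D` and the complement of its closure.
Near a vertex this decides membership in `D` from a single point of each convex piece. -/
theorem IsPreconnected.subset_of_disjoint_frontier {X : Type*} [TopologicalSpace X] {s D : Set X}
    (hs : IsPreconnected s) (hD : IsOpen D) (hd : Disjoint s (frontier D))
    (hne : (s ∩ D).Nonempty) : s ⊆ D := by
  refine hs.subset_left_of_subset_union hD isClosed_closure.isOpen_compl
    (Set.disjoint_compl_right_iff_subset.2 subset_closure) (fun x hx => ?_) hne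
  by_cases hxD : x ∈ D
  · exact Or.inl hxD
  · refine Or.inr fun hxc => Set.disjoint_left.1 hd hx ?_
    rw [hD.frontier_eq]
    exact ⟨hxc, hxD⟩

theorem lt_of_mem_segment_of_lt {ℓ : Plane →L[ℝ] ℝ} {a b x : Plane} {M : ℝ}
    (ha : ℓ a ≤ M) (hb : ℓ b < M) (hx : x ∈ segment ℝ a b) (hxa : x ≠ a) : ℓ x < M := by
  obtain ⟨s, t, hs, ht, hst, rfl⟩ := hx
  have ht0 : 0 < t := by
    rcases ht.eq_or_lt with h | h
    · exfalso
      apply hxa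
      have : s = 1 := by linarith
      simp [← h, this]
    · exact h
  simp only [map_add, map_smul, smul_eq_mul]
  have : s = 1 - t := by linarith
  subst this
  nlinarith

theorem Plane.mem_ball_add {p x : Plane} {r : ℝ} :
    p + x ∈ Metric.ball p r ↔ x ∈ Metric.ball 0 r := by
  simp

theorem exists_pos_add_smul_mem {E : Type*} [NormedAddCommGroup E] [NormedSpace ℝ E] {s : Set E}
    {x : E} (hs : s ∈ 𝓝 x) (u : E) : ∃ t : ℝ, 0 < t ∧ x + t • u ∈ s := by
  have hc : Tendsto (fun t : ℝ => x + t • u) (𝓝[>] 0) (𝓝 x) := by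
    have : Continuous fun t : ℝ => x + t • u := by fun_prop
    simpa using (this.tendsto 0).mono_left nhdsWithin_le_nhds
  obtain ⟨t, ht, ht0⟩ := ((hc.eventually hs).and self_mem_nhdsWithin).exists
  exact ⟨t, ht0, ht⟩

namespace IsPolygonWithVertices

variable {D : Set Plane} {m : ℕ} {v : Fin (m + 3) → Plane}

theorem linearIndependent (h : IsPolygonWithVertices D v) (i : Fin (m + 3)) :
    LinearIndependent ℝ ![v (i - 1) - v i, v (i + 1) - v i] := by
  have hc := h.corner i
  rw [collinear_iff_of_mem (p₀ := v i) (by simp)] at hc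
  refine LinearIndependent.pair_iff.2 fun s t hst => ?_
  by_contra hne
  apply hc
  by_cases hs : s = 0
  · have ht : t ≠ 0 := fun ht => hne ⟨hs, ht⟩
    have hb : v (i + 1) - v i = 0 := by
      simpa [hs, ht] using hst
    refine ⟨v (i - 1) - v i, ?_⟩
    simp only [Set.mem_insert_iff, Set.mem_singleton_iff, forall_eq_or_imp, forall_eq, vadd_eq_add]
    exact ⟨⟨1, by simp⟩, ⟨0, by simp⟩, ⟨0, by simpa [sub_eq_zero] using hb⟩⟩
  · refine ⟨v (i + 1) - v i, ?_⟩
    simp only [Set.mem_insert_iff, Set.mem_singleton_iff, forall_eq_or_imp, forall_eq, vadd_eq_add]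
    refine ⟨⟨- t / s, ?_⟩, ⟨0, by simp⟩, ⟨1, by simp⟩⟩
    rw [← sub_eq_iff_eq_add]
    have : s • (v (i - 1) - v i) = (-t) • (v (i + 1) - v i) := by
      rw [neg_smul]; exact eq_neg_of_add_eq_zero_left hst
    rw [div_eq_inv_mul, mul_smul, ← this, smul_smul, inv_mul_cancel₀ hs, one_smul]

theorem vertex_mem_frontier (h : IsPolygonWithVertices D v) (i : Fin (m + 3)) :
    v i ∈ frontier D := by
  rw [h.frontier_eq]
  exact Set.mem_iUnion.2 ⟨i, left_mem_segment _ _ _⟩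

/-- A linear functional that separates the vertices has a strict maximum over the polygon, at a
vertex. -/
theorem exists_vertex_isMax (h : IsPolygonWithVertices D v) {ℓ : Plane →L[ℝ] ℝ} {u : Plane}
    (hu : 0 < ℓ u) (hℓ : Function.Injective (ℓ ∘ v)) :
    ∃ i, (∀ j, j ≠ i → ℓ (v j) < ℓ (v i)) ∧ ∀ x ∈ closure D, x ≠ v i → ℓ x < ℓ (v i) := by
  obtain ⟨i, -, hi⟩ := Finset.exists_max_image Finset.univ (fun j => ℓ (v j)) ⟨0, by simp⟩
  have hi' : ∀ j, j ≠ i → ℓ (v j) < ℓ (v i) := fun j hj =>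
    lt_of_le_of_ne (hi j (Finset.mem_univ j)) fun he => hj (hℓ he)
  have hle : ∀ j, ℓ (v j) ≤ ℓ (v i) := fun j => hi j (Finset.mem_univ j)
  have hfr : ∀ x ∈ frontier D, x ≠ v i → ℓ x < ℓ (v i) := by
    intro x hx hxi
    rw [h.frontier_eq] at hx
    obtain ⟨j, hj⟩ := Set.mem_iUnion.1 hx
    by_cases hji : j = i
    · subst hji
      exact lt_of_mem_segment_of_lt le_rfl (hi' _ (by simp)) hj hxi
    -- The edge is reversed so that `v j`, known to lie strictly below the maximum, is the second
    -- endpoint; `v (j + 1)` may be the maximal vertex.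
    · rw [segment_symm] at hj
      by_cases hx1 : x = v (j + 1)
      · rw [hx1]
        exact hi' _ fun he => hxi (by rw [hx1, he])
      · exact lt_of_mem_segment_of_lt (hle _) (hi' j hji) hj hx1
  -- Moving along `u` rules out maxima in the interior, so the maximum over the closure is attained
  -- on the frontier.
  have hup : ∀ x ∈ D, ∃ y ∈ D, ℓ x < ℓ y := fun x hx => by
    obtain ⟨t, ht, hxt⟩ := exists_pos_add_smul_mem (h.isOpen.mem_nhds hx) u
    exact ⟨_, hxt, by simpa using mul_pos ht hu⟩
  have hmax : ∀ x ∈ closure D, ℓ x ≤ ℓ (v i) := by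
    obtain ⟨y, hy, hymax⟩ := h.isBounded.isCompact_closure.exists_isMaxOn
      (h.isConnected.nonempty.closure) ℓ.continuous.continuousOn
    have hyfr : y ∈ frontier D := by
      rw [h.isOpen.frontier_eq]
      refine ⟨hy, fun hyD => ?_⟩
      obtain ⟨y', hy', hlt⟩ := hup y hyD
      exact not_lt.2 (hymax (subset_closure hy')) hlt
    have hyle : ℓ y ≤ ℓ (v i) := by
      by_cases hyi : y = v i
      · rw [hyi]
      · exact (hfr y hyfr hyi).le
    exact fun x hx => (hymax hx).trans hyle
  refine ⟨i, hi', fun x hx hxi => ?_⟩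
  by_cases hxD : x ∈ D
  · obtain ⟨y, hy, hlt⟩ := hup x hxD
    exact hlt.trans_le (hmax y (subset_closure hy))
  · exact hfr x (by rw [h.isOpen.frontier_eq]; exact ⟨hx, hxD⟩) hxi

/-- Near a vertex at which a linear functional is strictly maximal, the polygon is a sector. -/
theorem exists_sector (h : IsPolygonWithVertices D v) {ℓ : Plane →L[ℝ] ℝ} {i : Fin (m + 3)}
    (hi : ∀ j, j ≠ i → ℓ (v j) < ℓ (v i)) (hmax : ∀ x ∈ closure D, x ≠ v i → ℓ x < ℓ (v i)) :
    ∃ Λ : (ℝ × ℝ) ≃L[ℝ] Plane, ℓ (Λ (1, 0)) < 0 ∧ ℓ (Λ (0, 1)) < 0 ∧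
      ∃ r > 0, ∀ z, Λ z ∈ Metric.ball 0 r → (v i + Λ z ∈ D ↔ 0 < z.1 ∧ 0 < z.2) := by
  obtain ⟨Λ, hΛ⟩ := exists_continuousLinearEquiv_of_linearIndependent (h.linearIndependent i)
  have ha : ℓ (Λ (1, 0)) < 0 := by
    have := hi (i - 1) (by simp)
    simp [hΛ, this]
  have hb : ℓ (Λ (0, 1)) < 0 := by
    have := hi (i + 1) (by simp)
    simp [hΛ, this]
  -- The edges not ending at `v i` form a closed set on which `ℓ < ℓ (v i)`. In a small ball only
  -- the two adjacent edges remain, lying on the nonnegative half-axes.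
  have hnb : ∃ r > 0, ∀ z, Λ z ∈ Metric.ball 0 r → v i + Λ z ∈ frontier D →
      0 ≤ z.1 ∧ 0 ≤ z.2 ∧ (z.1 = 0 ∨ z.2 = 0) := by
    let S : Set Plane := ⋃ j ∈ {j : Fin (m + 3) | j ≠ i ∧ j + 1 ≠ i}, segment ℝ (v j) (v (j + 1))
    have hSc : IsClosed S := (Set.toFinite _).isClosed_biUnion fun j _ => by
      rw [segment_eq_image_lineMap]
      exact (isCompact_Icc.image AffineMap.lineMap_continuous).isClosed
    have hiS : v i ∉ S := by
      intro hiS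
      obtain ⟨j, ⟨hj, hj1⟩, hij⟩ := Set.mem_iUnion₂.1 hiS
      have := lt_of_mem_segment_of_lt (hi j hj).le (hi _ hj1) hij
        fun he => hj (h.injective he.symm)
      exact lt_irrefl _ this
    obtain ⟨r, hr, hrS⟩ := Metric.mem_nhds_iff.1 (hSc.isOpen_compl.mem_nhds hiS)
    refine ⟨r, hr, fun z hz hzf => ?_⟩
    have hzS := hrS (Plane.mem_ball_add.2 hz)
    rw [h.frontier_eq] at hzf
    obtain ⟨j, hj⟩ := Set.mem_iUnion.1 hzf
    have hcoord : ∀ z' : ℝ × ℝ, v i + Λ z = v i + Λ z' → z = z' := fun z' he =>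
      Λ.injective (add_left_cancel he)
    by_cases hji : j = i
    · subst hji
      obtain ⟨s, t, hs, ht, hst, he⟩ := hj
      have hz' := hcoord (0, t) (by
        rw [← he, hΛ, eq_sub_of_add_eq hst]
        module)
      rw [hz']
      exact ⟨le_rfl, ht, Or.inl rfl⟩
    · by_cases hji' : j + 1 = i
      · have hj' : j = i - 1 := eq_sub_of_add_eq hji'
        rw [hji', hj'] at hj
        obtain ⟨s, t, hs, ht, hst, he⟩ := hj
        have hz' := hcoord (s, 0) (by
          rw [← he, hΛ, eq_sub_of_add_eq' hst]
          module)
        rw [hz']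
        exact ⟨hs, le_rfl, Or.inr rfl⟩
      · exact absurd (Set.mem_iUnion₂.2 ⟨j, ⟨hji, hji'⟩, hj⟩) hzS
  obtain ⟨r, hr, hrf⟩ := hnb
  refine ⟨Λ, ha, hb, r, hr, ?_⟩
  have hle : ∀ x ∈ D, ℓ x ≤ ℓ (v i) := fun x hx => by
    by_cases hxi : x = v i
    · rw [hxi]
    · exact (hmax x (subset_closure hx) hxi).le
  let V : Set (ℝ × ℝ) := {z | Λ z ∈ Metric.ball 0 r}
  have hVo : IsOpen V := Metric.isOpen_ball.preimage Λ.continuous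
  have hVc : Convex ℝ V := (convex_ball (0 : Plane) r).linear_preimage Λ.toLinearMap
  have hV0 : (0 : ℝ × ℝ) ∈ V := by simp [V, hr]
  let D' : Set (ℝ × ℝ) := {z | v i + Λ z ∈ D}
  let Ψ : (ℝ × ℝ) ≃ₜ Plane := Λ.toHomeomorph.trans (Homeomorph.addLeft (v i))
  have hD' : D' = Ψ ⁻¹' D := rfl
  have hD'o : IsOpen D' := h.isOpen.preimage Ψ.continuous
  have hD'f : ∀ z ∈ frontier D', v i + Λ z ∈ frontier D := fun z hz => by
    rw [hD', ← Ψ.preimage_frontier] at hz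
    exact hz
  have hsub : ∀ C : Set (ℝ × ℝ), Convex ℝ C → (∀ z ∈ C, z ∈ V ∧
      ¬ (0 ≤ z.1 ∧ 0 ≤ z.2 ∧ (z.1 = 0 ∨ z.2 = 0))) → (C ∩ D').Nonempty → C ⊆ D' := by
    intro C hC hCV hne
    refine hC.isPreconnected.subset_of_disjoint_frontier hD'o
      (Set.disjoint_left.2 fun z hz hzf => (hCV z hz).2 ?_) hne
    exact hrf z (hCV z hz).1 (hD'f z hzf)
  -- Here `ℓ` exceeds its maximum over `D`. This one exterior point lies in both open half-planes
  -- `z.1 < 0` and `z.2 < 0`, which miss the edges, so `D` avoids both near the vertex.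
  obtain ⟨ε, hε, hεV, hεn⟩ : ∃ ε : ℝ, 0 < ε ∧ ((-ε, -ε) : ℝ × ℝ) ∈ V ∧
      ((-ε, -ε) : ℝ × ℝ) ∉ D' := by
    obtain ⟨t, ht0, ht⟩ := exists_pos_add_smul_mem (hVo.mem_nhds hV0) (-1, -1)
    have he : (0 : ℝ × ℝ) + t • (-1, -1) = (-t, -t) := by simp
    rw [he] at ht
    refine ⟨t, ht0, ht, fun hD => ?_⟩
    have h1 := hle _ hD
    have h2 : Λ (-t, -t) = (-t) • Λ (1, 0) + (-t) • Λ (0, 1) := by simp [hΛ]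
    rw [h2] at h1
    simp only [map_add, map_smul, smul_eq_mul] at h1
    nlinarith
  have hlin1 : IsLinearMap ℝ (fun z : ℝ × ℝ => z.1) := (LinearMap.fst ℝ ℝ ℝ).isLinear
  have hlin2 : IsLinearMap ℝ (fun z : ℝ × ℝ => z.2) := (LinearMap.snd ℝ ℝ ℝ).isLinear
  have hneg1 : ∀ z ∈ V, z ∈ D' → 0 ≤ z.1 := fun z hzV hzD => by
    by_contra! hz
    exact hεn (hsub (V ∩ {z | z.1 < 0}) (hVc.inter (convex_halfSpace_lt hlin1 0))
      (fun z hz => ⟨hz.1, fun h' => absurd hz.2 (not_lt.2 h'.1)⟩) ⟨z, ⟨hzV, hz⟩, hzD⟩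
      ⟨hεV, by simpa using hε⟩)
  have hneg2 : ∀ z ∈ V, z ∈ D' → 0 ≤ z.2 := fun z hzV hzD => by
    by_contra! hz
    exact hεn (hsub (V ∩ {z | z.2 < 0}) (hVc.inter (convex_halfSpace_lt hlin2 0))
      (fun z hz => ⟨hz.1, fun h' => absurd hz.2 (not_lt.2 h'.2.1)⟩) ⟨z, ⟨hzV, hz⟩, hzD⟩
      ⟨hεV, by simpa using hε⟩)
  -- Openness excludes the axes: a small shift by `(-t, -t)` stays in `D'`.
  have hpos : ∀ z ∈ V, z ∈ D' → 0 < z.1 ∧ 0 < z.2 := fun z hzV hzD => by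
    obtain ⟨t, ht0, ht⟩ := exists_pos_add_smul_mem ((hVo.inter hD'o).mem_nhds ⟨hzV, hzD⟩)
      (-1, -1)
    have h1 := hneg1 _ ht.1 ht.2
    have h2 := hneg2 _ ht.1 ht.2
    simp only [Prod.fst_add, Prod.snd_add, Prod.smul_fst, Prod.smul_snd, smul_eq_mul] at h1 h2
    constructor <;> linarith
  intro z hz
  refine ⟨fun hzD => hpos z hz hzD, fun hz0 => ?_⟩
  -- The vertex is a limit of points of `D`, so `D` meets the open quadrant near it and therefore
  -- fills it there.
  have hcl : (0 : ℝ × ℝ) ∈ closure D' := by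
    rw [hD', ← Ψ.preimage_closure]
    have : Ψ 0 = v i := by
      change v i + Λ 0 = v i
      simp
    rw [Set.mem_preimage, this]
    exact frontier_subset_closure (h.vertex_mem_frontier i)
  obtain ⟨y, hyV, hyD⟩ := mem_closure_iff.1 hcl V hVo hV0
  refine hsub (V ∩ {z | 0 < z.1} ∩ {z | 0 < z.2})
    ((hVc.inter (convex_halfSpace_gt hlin1 0)).inter (convex_halfSpace_gt hlin2 0))
    (fun z hz => ⟨hz.1.1, fun h' => ?_⟩)
    ⟨y, ⟨⟨hyV, (hpos y hyV hyD).1⟩, (hpos y hyV hyD).2⟩, hyD⟩ ⟨⟨hz, hz0.1⟩, hz0.2⟩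
  rcases h'.2.2 with h'' | h''
  · exact hz.1.2.ne' h''
  · exact hz.2.ne' h''

end IsPolygonWithVertices

/-! ### Asymptotics of exponential moments -/

/-- The exponential with the real part `τ ℓ` and the imaginary part `√(τ² + κ) m` of the phase. -/
noncomputable def phaseWave (ℓ m : Plane →L[ℝ] ℝ) (κ τ : ℝ) (x : Plane) : ℂ :=
  Complex.exp (((τ * ℓ x : ℝ) : ℂ) + ((√(τ ^ 2 + κ) * m x : ℝ) : ℂ) * Complex.I)

section PhaseWave

variable {ℓ m : Plane →L[ℝ] ℝ} {κ : ℝ}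

theorem norm_phaseWave (τ : ℝ) (x : Plane) : ‖phaseWave ℓ m κ τ x‖ = Real.exp (τ * ℓ x) := by
  rw [phaseWave, Complex.exp_add, norm_mul, Complex.norm_exp_ofReal_mul_I, mul_one,
    Complex.norm_exp_ofReal]

theorem continuous_phaseWave (τ : ℝ) : Continuous (phaseWave ℓ m κ τ) := by
  unfold phaseWave
  fun_prop

/-- This allows recentring at a vertex: it multiplies all moments by one common factor. -/
theorem phaseWave_add (τ : ℝ) (x y : Plane) :
    phaseWave ℓ m κ τ (x + y) = phaseWave ℓ m κ τ x * phaseWave ℓ m κ τ y := by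
  simp only [phaseWave]
  rw [← Complex.exp_add]
  congr 1
  push_cast [map_add]
  ring

theorem tendsto_sqrt_div_atTop (κ : ℝ) :
    Tendsto (fun τ : ℝ => √(τ ^ 2 + κ) / τ) atTop (𝓝 1) := by
  have h1 : Tendsto (fun τ : ℝ => √(1 + κ / τ ^ 2)) atTop (𝓝 1) := by
    have h2 : Tendsto (fun τ : ℝ => κ / τ ^ 2) atTop (𝓝 0) :=
      tendsto_const_nhds.div_atTop (tendsto_pow_atTop two_ne_zero)
    have h3 := (h2.const_add 1).sqrt
    simpa using h3
  refine h1.congr' ?_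
  filter_upwards [eventually_gt_atTop 0] with τ hτ
  rw [eq_div_iff hτ.ne']
  nth_rewrite 2 [← Real.sqrt_sq hτ.le]
  rw [← Real.sqrt_mul' _ (sq_nonneg τ)]
  congr 1
  field_simp

/-- Sources bounded away from the maximum of the real phase have negligible moments. -/
theorem tendsto_setIntegral_phaseWave_zero {S : Set Plane} (hS : MeasurableSet S) {ρ : Plane → ℂ}
    (hρ : IntegrableOn ρ S) {p : Plane} {δ : ℝ} (hδ : 0 < δ) (hℓ : ∀ x ∈ S, ℓ (x - p) ≤ -δ) :
    Tendsto (fun τ : ℝ => (τ : ℂ) ^ 2 * ∫ x in S, ρ x * phaseWave ℓ m κ τ (x - p)) atTop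
      (𝓝 0) := by
  have h1 := (tendsto_rpow_mul_exp_neg_mul_atTop_nhds_zero 2 δ hδ).mul_const (∫ x in S, ‖ρ x‖)
  rw [zero_mul] at h1
  refine squeeze_zero_norm' ?_ h1
  filter_upwards [eventually_ge_atTop 0] with τ hτ
  have h2 : ‖∫ x in S, ρ x * phaseWave ℓ m κ τ (x - p)‖ ≤
      ∫ x in S, Real.exp (-δ * τ) * ‖ρ x‖ := by
    refine norm_integral_le_of_norm_le (hρ.norm.const_mul _) ?_
    refine (ae_restrict_iff' hS).2 (Eventually.of_forall fun x hx => ?_)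
    rw [norm_mul, norm_phaseWave, mul_comm]
    refine mul_le_mul_of_nonneg_right (Real.exp_le_exp.2 ?_) (norm_nonneg _)
    nlinarith [mul_le_mul_of_nonneg_left (hℓ x hx) hτ]
  rw [integral_const_mul] at h2
  rw [norm_mul, norm_pow, Complex.norm_real, Real.norm_of_nonneg hτ, Real.rpow_two, mul_assoc]
  gcongr

/-- The leading term of the moments of a source supported in a sector. -/
theorem tendsto_integral_sector_phaseWave (Λ : (ℝ × ℝ) ≃L[ℝ] Plane) (hA : ℓ (Λ (1, 0)) < 0)
    (hB : ℓ (Λ (0, 1)) < 0) {p : Plane} {g : Plane → ℂ} (hg : Measurable g) {M : ℝ}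
    (hM : ∀ x, ‖g x‖ ≤ M) (hgp : ContinuousAt g p) :
    Tendsto (fun τ : ℝ => (τ : ℂ) ^ 2 * ∫ z : ℝ × ℝ, (Set.Ioi 0 ×ˢ Set.Ioi 0).indicator
      (fun z => g (p + Λ z) * phaseWave ℓ m κ τ (Λ z)) z) atTop
      (𝓝 (g p / ((ℓ (Λ (1, 0)) + m (Λ (1, 0)) * Complex.I) *
        (ℓ (Λ (0, 1)) + m (Λ (0, 1)) * Complex.I)))) := by
  set Q : Set (ℝ × ℝ) := Set.Ioi 0 ×ˢ Set.Ioi 0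
  have hQ : MeasurableSet Q := measurableSet_Ioi.prod measurableSet_Ioi
  set A : ℂ := ℓ (Λ (1, 0)) + m (Λ (1, 0)) * Complex.I with hAdef
  set B : ℂ := ℓ (Λ (0, 1)) + m (Λ (0, 1)) * Complex.I with hBdef
  have hAre : A.re = ℓ (Λ (1, 0)) := by simp [hAdef]
  have hBre : B.re = ℓ (Λ (0, 1)) := by simp [hBdef]
  have hlin : ∀ (f : Plane →L[ℝ] ℝ) (z : ℝ × ℝ),
      f (Λ z) = z.1 * f (Λ (1, 0)) + z.2 * f (Λ (0, 1)) := fun f z => by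
    have : z = z.1 • ((1 : ℝ), (0 : ℝ)) + z.2 • ((0 : ℝ), (1 : ℝ)) := by simp
    conv_lhs => rw [this]
    simp only [map_add, map_smul, smul_eq_mul]
  -- The substitution `z ↦ τ⁻¹ z` preserves the quadrant, and its Jacobian in dimension two accounts
  -- for `τ²`. The real phase becomes independent of `τ`.
  have hscale : ∀ᶠ τ : ℝ in atTop, (∫ z : ℝ × ℝ, Q.indicator (fun z => g (p + τ⁻¹ • Λ z) *
      Complex.exp (ℓ (Λ z) + (√(τ ^ 2 + κ) / τ * m (Λ z) : ℝ) * Complex.I)) z) =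
      (τ : ℂ) ^ 2 * ∫ z : ℝ × ℝ, Q.indicator
        (fun z => g (p + Λ z) * phaseWave ℓ m κ τ (Λ z)) z := by
    filter_upwards [eventually_gt_atTop 0] with τ hτ
    have h1 := Measure.integral_comp_smul (volume : Measure (ℝ × ℝ)) (Q.indicator
        (fun z => g (p + Λ z) * phaseWave ℓ m κ τ (Λ z))) τ⁻¹
    have hf : Module.finrank ℝ (ℝ × ℝ) = 2 := by simp
    rw [hf, inv_pow, inv_inv, abs_of_nonneg (sq_nonneg τ), Complex.real_smul] at h1
    push_cast at h1
    rw [← h1]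
    congr 1 with z
    have hmem : τ⁻¹ • z ∈ Q ↔ z ∈ Q := by
      simp [Q, Set.mem_prod, hτ]
    by_cases hz : z ∈ Q
    · rw [Set.indicator_of_mem hz, Set.indicator_of_mem (hmem.2 hz)]
      simp only [map_smul, phaseWave, smul_eq_mul]
      congr 3
      · congr 1
        field_simp
      · congr 2
        ring
    · rw [Set.indicator_of_notMem hz, Set.indicator_of_notMem (fun h => hz (hmem.1 h))]
  refine Tendsto.congr' hscale ?_
  have hsplit : ∀ {β : Type} [MulZeroClass β] (f₁ f₂ : ℝ → β) (z : ℝ × ℝ),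
      Q.indicator (fun z => f₁ z.1 * f₂ z.2) z =
        (Set.Ioi 0).indicator f₁ z.1 * (Set.Ioi 0).indicator f₂ z.2 := fun f₁ f₂ z => by
    simp only [Set.indicator, Q, Set.mem_prod]
    by_cases h1 : z.1 ∈ Set.Ioi (0 : ℝ) <;> by_cases h2 : z.2 ∈ Set.Ioi (0 : ℝ) <;> simp [h1, h2]
  -- The limit integrand factors. Each factor gives `∫₀^∞ exp (A s) ds = -1 / A`, and the two signs
  -- cancel.
  have hval : ∫ z : ℝ × ℝ, Q.indicator (fun z => g p *
      Complex.exp (ℓ (Λ z) + m (Λ z) * Complex.I)) z = g p / (A * B) := by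
    have h1 : ∀ z : ℝ × ℝ, Q.indicator (fun z => g p *
        Complex.exp (ℓ (Λ z) + m (Λ z) * Complex.I)) z =
        g p * ((Set.Ioi 0).indicator (fun s : ℝ => Complex.exp (A * s)) z.1 *
          (Set.Ioi 0).indicator (fun s : ℝ => Complex.exp (B * s)) z.2) := fun z => by
      rw [← hsplit, ← Set.indicator_const_mul]
      congr 1
      funext z
      rw [← Complex.exp_add, hlin ℓ z, hlin m z]
      congr 2
      push_cast
      ring
    simp only [h1]
    rw [integral_const_mul, Measure.volume_eq_prod, integral_prod_mul,
      integral_indicator measurableSet_Ioi, integral_indicator measurableSet_Ioi,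
      integral_exp_mul_complex_Ioi (by rw [hAre]; exact hA),
      integral_exp_mul_complex_Ioi (by rw [hBre]; exact hB)]
    have hA0 : A ≠ 0 := fun h => by rw [h] at hAre; simp at hAre; linarith
    have hB0 : B ≠ 0 := fun h => by rw [h] at hBre; simp at hBre; linarith
    simp
    field_simp
  rw [← hval]
  have hM0 : 0 ≤ M := (norm_nonneg _).trans (hM p)
  refine tendsto_integral_filter_of_dominated_convergence
    (fun z => M * ((Set.Ioi 0).indicator (fun s : ℝ => Real.exp (ℓ (Λ (1, 0)) * s)) z.1 *
          (Set.Ioi 0).indicator (fun s : ℝ => Real.exp (ℓ (Λ (0, 1)) * s)) z.2)) ?_ ?_ ?_ ?_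
  · refine Eventually.of_forall fun τ => (Measurable.indicator ?_ hQ).aestronglyMeasurable
    refine (hg.comp (by fun_prop)).mul (Continuous.measurable ?_)
    fun_prop
  · refine Eventually.of_forall fun τ => Eventually.of_forall fun z => ?_
    rw [← hsplit, norm_indicator_eq_indicator_norm, ← Set.indicator_const_mul]
    refine Set.indicator_le_indicator ?_
    rw [norm_mul, Complex.exp_add, norm_mul, Complex.norm_exp_ofReal_mul_I, mul_one,
      Complex.norm_exp_ofReal, ← Real.exp_add]
    refine mul_le_mul (hM _) (le_of_eq ?_) (Real.exp_pos _).le hM0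
    rw [hlin]
    ring_nf
  · refine Integrable.const_mul ?_ M
    rw [Measure.volume_eq_prod]
    refine Integrable.mul_prod ?_ ?_
    · exact (integrableOn_exp_mul_Ioi hA 0).integrable_indicator measurableSet_Ioi
    · exact (integrableOn_exp_mul_Ioi hB 0).integrable_indicator measurableSet_Ioi
  · refine Eventually.of_forall fun z => ?_
    by_cases hz : z ∈ Q
    · simp only [Set.indicator_of_mem hz]
      have h1 : Tendsto (fun τ : ℝ => p + τ⁻¹ • Λ z) atTop (𝓝 p) := by
        have := (tendsto_inv_atTop_zero (𝕜 := ℝ)).smul_const (Λ z)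
        simpa using this.const_add p
      refine (hgp.tendsto.comp h1).mul ?_
      have h2 := ((tendsto_sqrt_div_atTop κ).mul_const (m (Λ z)))
      rw [one_mul] at h2
      have h3 := (Complex.continuous_ofReal.tendsto _).comp h2
      exact (Complex.continuous_exp.tendsto _).comp ((h3.mul_const Complex.I).const_add _)
    · simp only [Set.indicator_of_notMem hz]
      exact tendsto_const_nhds

end PhaseWave

/-- The exponential moments of an admissible source detect the vertex at which the real phase is
maximal. -/
theorem IsAdmissiblePair.exists_tendsto_moment {Ω D : Set Plane} {ρ : Plane → ℂ}
    (h : IsAdmissiblePair Ω D ρ) {n : ℕ} {v : Fin (n + 3) → Plane}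
    (hv : IsPolygonWithVertices D v) {ℓ : Plane →L[ℝ] ℝ} {u : Plane} (hu : 0 < ℓ u)
    (hℓ : Function.Injective (ℓ ∘ v)) (m : Plane →L[ℝ] ℝ) (κ : ℝ) :
    ∃ p, (∀ x ∈ D, ℓ x ≤ ℓ p) ∧ ∃ L : ℂ, L ≠ 0 ∧
      Tendsto (fun τ : ℝ => (τ : ℂ) ^ 2 * ∫ x in D, ρ x * phaseWave ℓ m κ τ (x - p)) atTop
        (𝓝 L) := by
  obtain ⟨i, hi, hmax⟩ := hv.exists_vertex_isMax hu hℓ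
  obtain ⟨Λ, hA, hB, r, hr, hsec⟩ := hv.exists_sector hi hmax
  set p := v i with hp
  have hle : ∀ x ∈ D, ℓ x ≤ ℓ p := fun x hx => by
    by_cases hxi : x = p
    · rw [hxi]
    · exact (hmax x (subset_closure hx) hxi).le
  obtain ⟨η, α, C, ρ', hη, hα, -, hρ', hae, hρ'p⟩ := h.vertex p ⟨n, v, hv, i, rfl⟩
  have hρ'c : ContinuousOn ρ' (Metric.closedBall p η) := hρ'.continuousOn hα
  obtain ⟨M, hM⟩ := (isCompact_closedBall p η).exists_bound_of_continuousOn hρ'c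
  have hM0 : 0 ≤ M := (norm_nonneg _).trans (hM p (Metric.mem_closedBall_self hη.le))
  -- Within this radius both the sector description of `D` and the Hölder representative of `ρ` are
  -- available.
  set r₀ := min r η with hr₀
  have hr₀pos : 0 < r₀ := lt_min hr hη
  set b := Metric.ball p r₀ with hb
  have hbη : b ⊆ Metric.closedBall p η :=
    (Metric.ball_subset_ball (min_le_right _ _)).trans Metric.ball_subset_closedBall
  -- Extension by zero makes the density bounded and measurable on the whole plane and lets the
  -- integral run over the entire infinite sector.
  set g := b.indicator ρ' with hg
  have hgm : Measurable g := by
    classical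
    rw [hg, ← Set.piecewise_eq_indicator]
    exact (hρ'c.mono hbη).measurable_piecewise continuousOn_const Metric.isOpen_ball.measurableSet
  have hgM : ∀ x, ‖g x‖ ≤ M := fun x => by
    by_cases hx : x ∈ b
    · rw [hg, Set.indicator_of_mem hx]
      exact hM x (hbη hx)
    · rw [hg, Set.indicator_of_notMem hx, norm_zero]
      exact hM0
  have hgp : g p = ρ' p := Set.indicator_of_mem (Metric.mem_ball_self hr₀pos) _
  have hgc : ContinuousAt g p := by
    refine (hρ'c.continuousAt (Metric.closedBall_mem_nhds p hη)).congr ?_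
    filter_upwards [Metric.ball_mem_nhds p hr₀pos] with x hx
    rw [hg, Set.indicator_of_mem hx]
  obtain ⟨c, hc0, hc⟩ := exists_integral_eq_smul_integral_comp Λ p
  have hDm : MeasurableSet D := hv.isOpen.measurableSet
  have hbm : MeasurableSet b := Metric.isOpen_ball.measurableSet
  have hρint : IntegrableOn ρ D := by
    have : IsFiniteMeasure (volume.restrict D) := ⟨by simpa using hv.isBounded.measure_lt_top⟩
    exact h.memLp.integrable (by norm_num)
  have hnear : ∀ τ, ∫ x in D ∩ b, ρ x * phaseWave ℓ m κ τ (x - p) =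
      (c : ℂ) * ∫ z : ℝ × ℝ, (Set.Ioi 0 ×ˢ Set.Ioi 0).indicator
      (fun z => g (p + Λ z) * phaseWave ℓ m κ τ (Λ z)) z := by
    intro τ
    have h1 : ∫ x in D ∩ b, ρ x * phaseWave ℓ m κ τ (x - p) =
        ∫ x in D ∩ b, ρ' x * phaseWave ℓ m κ τ (x - p) := by
      refine integral_congr_ae ?_
      have hsub : D ∩ b ⊆ Metric.ball p η ∩ D := fun x hx =>
        ⟨Metric.ball_subset_ball (min_le_right _ _) hx.2, hx.1⟩
      filter_upwards [ae_mono (Measure.restrict_mono hsub le_rfl) hae] with x hx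
      rw [hx]
    rw [h1, ← integral_indicator (hDm.inter hbm), hc, Complex.real_smul]
    congr 2 with z
    by_cases hz : p + Λ z ∈ b
    · have hz' : Λ z ∈ Metric.ball 0 r :=
        Plane.mem_ball_add.1 (Metric.ball_subset_ball (min_le_left _ _) hz)
      have hiff : p + Λ z ∈ D ↔ z ∈ Set.Ioi (0 : ℝ) ×ˢ Set.Ioi (0 : ℝ) := hsec z hz'
      by_cases hzD : p + Λ z ∈ D
      · rw [Set.indicator_of_mem (Set.mem_inter hzD hz), Set.indicator_of_mem (hiff.1 hzD), hg,
          Set.indicator_of_mem hz, add_sub_cancel_left]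
      · rw [Set.indicator_of_notMem (fun h => hzD (Set.inter_subset_left h)),
          Set.indicator_of_notMem (fun h => hzD (hiff.2 h))]
    · rw [Set.indicator_of_notMem (fun h => hz (Set.inter_subset_right h))]
      simp [Set.indicator_apply, hg, hz]
  -- Strict maximality at `p` becomes a uniform gap by compactness of `closure D \ b`; if that set
  -- is empty, any positive `δ` serves.
  obtain ⟨δ, hδ, hfar⟩ : ∃ δ > 0, ∀ x ∈ D \ b, ℓ (x - p) ≤ -δ := by
    have hK : IsCompact (closure D \ b) := hv.isBounded.isCompact_closure.diff Metric.isOpen_ball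
    rcases (closure D \ b).eq_empty_or_nonempty with he | hne
    · refine ⟨1, one_pos, fun x hx => ?_⟩
      have : x ∈ closure D \ b := ⟨subset_closure hx.1, hx.2⟩
      rw [he] at this
      exact this.elim
    · obtain ⟨y, hy, hymax⟩ := hK.exists_isMaxOn hne ℓ.continuous.continuousOn
      have hyp : y ≠ p := fun he => hy.2 (by rw [he]; exact Metric.mem_ball_self hr₀pos)
      refine ⟨ℓ p - ℓ y, sub_pos.2 (hmax y hy.1 hyp), fun x hx => ?_⟩
      have : ℓ x ≤ ℓ y := hymax (⟨subset_closure hx.1, hx.2⟩ : x ∈ closure D \ b)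
      rw [map_sub]
      linarith
  have t1 := (tendsto_integral_sector_phaseWave (m := m) (κ := κ) Λ hA hB hgm hgM hgc).const_mul
    (c : ℂ)
  have t2 := tendsto_setIntegral_phaseWave_zero (m := m) (κ := κ) (hDm.diff hbm)
    (hρint.mono_set Set.sdiff_subset) hδ hfar
  refine ⟨p, hle, _, ?_, (t1.add t2).congr fun τ => ?_⟩
  · have hne : ∀ {a b : ℝ}, a < 0 → (a + b * Complex.I : ℂ) ≠ 0 := fun {a b} ha he => by
      have := congrArg Complex.re he
      simp at this
      exact ha.ne this
    rw [add_zero, hgp]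
    exact mul_ne_zero (by exact_mod_cast hc0)
      (div_ne_zero hρ'p (mul_ne_zero (hne hA) (hne hB)))
  · have hint : IntegrableOn (fun x => ρ x * phaseWave ℓ m κ τ (x - p)) D := by
      have hcont : Continuous fun x => phaseWave ℓ m κ τ (x - p) :=
        (continuous_phaseWave τ).comp (continuous_id.sub continuous_const)
      obtain ⟨M', hM'⟩ := hv.isBounded.isCompact_closure.exists_bound_of_continuousOn
        hcont.continuousOn
      exact hρint.mul_bdd hcont.aestronglyMeasurable
        ((ae_restrict_iff' hDm).2 (Eventually.of_forall fun x hx => hM' x (subset_closure hx)))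
    rw [← integral_inter_add_sdiff hbm hint, hnear]
    ring

/-! ### Choice of the direction and the comparison of hulls -/

/-- The rotation of a vector of the plane by a right angle. -/
noncomputable def Plane.rot (ξ : Plane) : Plane := !₂[-ξ 1, ξ 0]

/-- Plane vectors `ξ` for which `⟪ξ, ·⟫` separates the points of a finite family are dense. -/
theorem dense_setOf_injective_inner {ι : Type*} [Finite ι] {v : ι → Plane}
    (hv : Function.Injective v) :
    Dense {ξ : Plane | Function.Injective (innerSL ℝ ξ ∘ v)} := by
  -- The excluded `ξ` are orthogonal to `v i - v j`, hence lie in a proper subspace, which is null.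
  have h1 : ∀ i j, i ≠ j → ∀ᵐ ξ : Plane, innerSL ℝ ξ (v i) ≠ innerSL ℝ ξ (v j) := by
    intro i j hij
    have hy : v i - v j ≠ 0 := sub_ne_zero.2 (hv.ne hij)
    let S : Submodule ℝ Plane := LinearMap.ker (innerSL ℝ (v i - v j)).toLinearMap
    have hS : S ≠ ⊤ := fun hS => by
      have : v i - v j ∈ S := by rw [hS]; trivial
      have h0 : inner ℝ (v i - v j) (v i - v j) = 0 := this
      exact hy (inner_self_eq_zero.1 h0)
    have := Measure.addHaar_submodule volume S hS
    refine measure_mono_null (fun ξ hξ => ?_) this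
    have hξ : innerSL ℝ ξ (v i) = innerSL ℝ ξ (v j) := not_not.1 hξ
    simp only [innerSL_apply_apply] at hξ
    change inner ℝ (v i - v j) ξ = 0
    rw [inner_sub_left, real_inner_comm, hξ, real_inner_comm, sub_self]
  have h2 : ∀ᵐ ξ : Plane, ∀ i j, i ≠ j → innerSL ℝ ξ (v i) ≠ innerSL ℝ ξ (v j) := by
    rw [ae_all_iff]
    intro i
    rw [ae_all_iff]
    intro j
    by_cases hij : i = j
    · simp [hij]
    · filter_upwards [h1 i j hij] with ξ hξ _ using hξ
  refine (Measure.dense_of_ae h2).mono fun ξ hξ i j hij => ?_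
  by_contra hne
  exact hξ i j hne hij

/-- The exponential with the phase in the direction `ξ` solves the Helmholtz equation. -/
theorem exists_expWave_eq_phaseWave {ξ : Plane} (hξ : ξ ≠ 0) (k τ : ℝ) :
    ∃ z : Fin 2 → ℂ, ∑ i, z i ^ 2 = -(k : ℂ) ^ 2 ∧ expWave z =
      phaseWave (innerSL ℝ ξ) (innerSL ℝ ξ.rot) (k ^ 2 / (ξ 0 ^ 2 + ξ 1 ^ 2)) τ := by
  have hpos : 0 < ξ 0 ^ 2 + ξ 1 ^ 2 := by
    by_contra! h
    apply hξ
    ext i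
    fin_cases i <;> simp <;> nlinarith [sq_nonneg (ξ 0), sq_nonneg (ξ 1)]
  set κ := k ^ 2 / (ξ 0 ^ 2 + ξ 1 ^ 2) with hκ
  have hκ0 : 0 ≤ κ := by positivity
  set s := √(τ ^ 2 + κ) with hs
  have hss : s ^ 2 = τ ^ 2 + κ := Real.sq_sqrt (by positivity)
  have hkk : κ * (ξ 0 ^ 2 + ξ 1 ^ 2) = k ^ 2 := div_mul_cancel₀ _ hpos.ne'
  -- This is `τ ξ + i s ξ^⊥`, so `z·z = (τ² - s²) |ξ|² = -κ |ξ|² = -k²`; as `ξ` is not normalised,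
  -- `κ` carries the factor `|ξ|⁻²`.
  refine ⟨![τ * ξ 0 - s * ξ 1 * Complex.I, τ * ξ 1 + s * ξ 0 * Complex.I], ?_, ?_⟩
  · have hI := Complex.I_sq
    have hss' : (s : ℂ) ^ 2 = τ ^ 2 + κ := by exact_mod_cast hss
    have hkk' : (κ : ℂ) * (ξ 0 ^ 2 + ξ 1 ^ 2) = k ^ 2 := by exact_mod_cast hkk
    simp only [Fin.sum_univ_two, Matrix.cons_val_zero, Matrix.cons_val_one,
      Matrix.cons_val_fin_one]
    linear_combination (s ^ 2 * (ξ 0 ^ 2 + ξ 1 ^ 2) : ℂ) * hI -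
      (ξ 0 ^ 2 + ξ 1 ^ 2 : ℂ) * hss' - hkk'
  · funext x
    simp only [expWave, phaseWave, Plane.rot, innerSL_apply_apply]
    congr 1
    rw [← hs]
    simp [Fin.sum_univ_two, PiLp.inner_apply]
    ring

/-- A polygonal source with the same exponential moments as another one lies in the convex hull of
the latter. -/
theorem IsAdmissiblePair.subset_convexHull_of_moments_eq {Ω D₁ D₂ : Set Plane} {ρ₁ ρ₂ : Plane → ℂ}
    (h₁ : IsAdmissiblePair Ω D₁ ρ₁) (h₂ : IsAdmissiblePair Ω D₂ ρ₂) {k : ℝ}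
    (heq : ∀ z : Fin 2 → ℂ, ∑ i, z i ^ 2 = -(k : ℂ) ^ 2 →
      ∫ x in D₁, ρ₁ x * expWave z x = ∫ x in D₂, ρ₂ x * expWave z x) :
    D₁ ⊆ convexHull ℝ D₂ := by
  intro x₀ hx₀
  by_contra hx₀'
  obtain ⟨n, v, hv⟩ := h₁.isPolygon
  obtain ⟨n₂, v₂, hv₂⟩ := h₂.isPolygon
  obtain ⟨f, hf⟩ := geometric_hahn_banach_open_point (convex_convexHull ℝ D₂)
    hv₂.isOpen.convexHull hx₀'
  set ξ₀ := (InnerProductSpace.toDual ℝ Plane).symm f with hξ₀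
  have hfξ : ∀ x, f x = inner ℝ ξ₀ x := fun x =>
    (InnerProductSpace.toDual_symm_apply (𝕜 := ℝ)).symm
  have hf0 : ξ₀ ≠ 0 := fun h => by
    obtain ⟨y, hy⟩ := hv₂.isConnected.nonempty
    have := hf y (subset_convexHull ℝ D₂ hy)
    simp [hfξ, h] at this
  -- Separation at `x₀` is strict only pointwise. Moving inside the open set `D₁` to `x₁` produces a
  -- uniform gap `δ`.
  obtain ⟨t, ht, hx₁⟩ := exists_pos_add_smul_mem (hv.isOpen.mem_nhds hx₀) ξ₀
  set x₁ := x₀ + t • ξ₀ with hx₁def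
  set δ := inner ℝ ξ₀ x₁ - inner ℝ ξ₀ x₀ with hδdef
  have hδ : 0 < δ := by
    rw [hδdef, hx₁def, inner_add_right, inner_smul_right, add_sub_cancel_left]
    exact mul_pos ht (real_inner_self_pos.2 hf0)
  obtain ⟨R, hR0, hR⟩ := hv₂.isBounded.exists_pos_norm_lt
  set R' := R + ‖x₁‖ with hR'
  have hR'0 : 0 < R' := by positivity
  -- Since `‖y - x₁‖ ≤ R'` on `D₂`, the first bound costs at most half of the gap; the second keeps
  -- `ξ ≠ 0`.
  obtain ⟨ξ, hξinj, hξd⟩ := (dense_setOf_injective_inner hv.injective).exists_dist_lt ξ₀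
    (show 0 < min (δ / (2 * R')) ‖ξ₀‖ from lt_min (by positivity) (norm_pos_iff.2 hf0))
  have hξ0 : ξ ≠ 0 := fun h => by
    rw [h, dist_zero_right] at hξd
    exact absurd (hξd.trans_le (min_le_right _ _)) (lt_irrefl _)
  have hgap : ∀ y ∈ D₂, inner ℝ ξ (y - x₁) ≤ -(δ / 2) := by
    intro y hy
    have h1 := hf y (subset_convexHull ℝ D₂ hy)
    rw [hfξ, hfξ] at h1
    have h2 : inner ℝ ξ (y - x₁) = inner ℝ ξ₀ (y - x₁) + inner ℝ (ξ - ξ₀) (y - x₁) := by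
      rw [inner_sub_left]; ring
    have h3 : inner ℝ (ξ - ξ₀) (y - x₁) ≤ δ / 2 := by
      refine (real_inner_le_norm _ _).trans ?_
      have h4 : ‖y - x₁‖ ≤ R' := (norm_sub_le _ _).trans (by
        rw [hR']
        gcongr
        exact (hR y hy).le)
      have h5 : ‖ξ - ξ₀‖ ≤ δ / (2 * R') := by
        rw [← dist_eq_norm, dist_comm]
        exact (hξd.trans_le (min_le_left _ _)).le
      calc ‖ξ - ξ₀‖ * ‖y - x₁‖ ≤ δ / (2 * R') * R' := by gcongr
        _ = δ / 2 := by field_simp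
    rw [h2, inner_sub_right]
    linarith
  set ℓ := innerSL ℝ ξ
  set m := innerSL ℝ ξ.rot
  set κ := k ^ 2 / (ξ 0 ^ 2 + ξ 1 ^ 2)
  obtain ⟨p, hp, L, hL, hlim⟩ := h₁.exists_tendsto_moment hv (ℓ := ℓ) (u := ξ)
    (by simpa [ℓ] using real_inner_self_pos.2 hξ0) hξinj m κ
  have hint₂ : IntegrableOn ρ₂ D₂ := by
    have : IsFiniteMeasure (volume.restrict D₂) :=
      ⟨by simpa using hv₂.isBounded.measure_lt_top⟩
    exact h₂.memLp.integrable (by norm_num)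
  -- The gap passes from `x₁` to `p` because `ℓ x₁ ≤ ℓ p`, as `x₁ ∈ D₁`.
  have hlim₂ := tendsto_setIntegral_phaseWave_zero (ℓ := ℓ) (m := m) (κ := κ) (p := p)
    hv₂.isOpen.measurableSet hint₂ (half_pos hδ) fun y hy => by
      have h1 := hgap y hy
      have h2 := hp x₁ hx₁
      rw [inner_sub_right] at h1
      simp only [map_sub, ℓ, innerSL_apply_apply] at h2 ⊢
      linarith
  refine hL (tendsto_nhds_unique hlim (hlim₂.congr fun τ => ?_))
  obtain ⟨z, hz, hzw⟩ := exists_expWave_eq_phaseWave hξ0 k τ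
  have h3 := heq z hz
  rw [hzw] at h3
  have h4 : ∀ (ρ : Plane → ℂ) (D : Set Plane), ∫ x in D, ρ x * phaseWave ℓ m κ τ (x - p) =
      (∫ x in D, ρ x * phaseWave ℓ m κ τ x) * phaseWave ℓ m κ τ (-p) := fun ρ D => by
    rw [← integral_mul_const]
    congr 1 with x
    rw [sub_eq_add_neg, phaseWave_add, mul_assoc]
  rw [h4, h4, h3]

theorem corollary1 (Ω : Set Plane) (hΩ : IsBoundedLipschitzDomain Ω) (k : ℝ) (hk : 0 ≤ k)
    (D₁ D₂ : Set Plane) (ρ₁ ρ₂ : Plane → ℂ)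
    (h₁ : IsAdmissiblePair Ω D₁ ρ₁) (h₂ : IsAdmissiblePair Ω D₂ ρ₂)
    (u₁ u₂ : H1 Ω)
    (hu₁ : IsWeakSolution k (sourceFunctional Ω D₁ ρ₁) u₁)
    (hu₂ : IsWeakSolution k (sourceFunctional Ω D₂ ρ₂) u₂)
    (hCauchy : ∃ (f : HHalf Ω) (N : HHalf Ω →ₗ[ℂ] ℂ),
      IsCauchyData k (sourceFunctional Ω D₁ ρ₁) u₁ f N ∧
      IsCauchyData k (sourceFunctional Ω D₂ ρ₂) u₂ f N) :
    convexHull ℝ D₁ = convexHull ℝ D₂ := by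
  obtain ⟨f, N, hN₁, hN₂⟩ := hCauchy
  have heq : ∀ z : Fin 2 → ℂ, ∑ i, z i ^ 2 = -(k : ℂ) ^ 2 →
      ∫ x in D₁, ρ₁ x * expWave z x = ∫ x in D₂, ρ₂ x * expWave z x :=
    fun z hz => sourceFunctional_expWave_eq hΩ hN₁ hN₂ hz
  exact Set.Subset.antisymm
    (convexHull_min (h₁.subset_convexHull_of_moments_eq h₂ heq) (convex_convexHull ℝ D₂))
    (convexHull_min (h₂.subset_convexHull_of_moments_eq h₁ fun z hz => (heq z hz).symm)
      (convex_convexHull ℝ D₁))
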